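/- Let $\mathbb{F}=\mathbb{R}$ or $\mathbb{C}$. A \emph{basis} of a quasi-Banach space $\mathbb{X}$ over $\mathbb{F}$ is a sequence $\mathcal{X}=(x_n)_{n=1}^\infty$ with dense linear span in $\mathbb{X}$ for which there are (necessarily unique) bounded linear functionals $(x_n^*)_{n=1}^\infty$ on $\mathbb{X}$ with $x_n^*(x_k)=\delta_{n,k}$. The basis is \emph{$M$-bounded} if $\sup_n\|x_n\|\,\|x_n^*\|<\infty$, and \emph{total} if $f\mapsto (x_n^*(f))_{n=1}^\infty$ is one-to-one on $\mathbb{X}$. For $m\in\mathbb{N}$ put \[ \tilde{\boldsymbol{k}}_m[\mathcal{X},\mathbb{X}]=\sup\Big\{\Big\|\sum_{n\in A}x_n^*(f)\,x_n\Big\| : f\in\operatorname{span}(x_1,\dots,x_m),\ \|f\|\le 1,\ A\subseteq\mathbb{N}\text{ finite}\Big\}. \] A \emph{symmetric sequence space} is a quasi-Banach space $\mathbb{S}\subseteq\mathbb{F}^{\mathbb{N}}$ with bounded coordinate functionals that contains the finitely supported sequences as a dense subspace and whose unit vectors $(e_n)_{n=1}^\infty$ satisfy $\big\|\sum_n\varepsilon_n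 a_n e_{\pi(n)}\big\|=\big\|\sum_n a_n e_n\big\|$ for all finitely supported scalar sequences $(a_n)_{n=1}^\infty$, all scalars $\varepsilon_n$ with $|\varepsilon_n|=1$, and all permutations $\pi$ of $\mathbb{N}$. It is \emph{locally convex} if its topology is, and it is \emph{complemented} in $\mathbb{X}$ if it is isomorphic to the range of a bounded linear projection on $\mathbb{X}$. \textbf{Theorem.} Let $\mathbb{X}$ be a quasi-Banach space over $\mathbb{F}$ with an $M$-bounded basis $\mathcal{X}$, and suppose that a locally convex symmetric sequence space $\mathbb{S}$ (over $\mathbb{F}$) is complemented in $\mathbb{X}$. Then $\mathbb{X}$ has an $M$-bounded basis $\mathcal{B}$ for which there is a constant $c>0$ with \[ \tilde{\boldsymbol{k}}_m[\mathcal{B},\mathbb{X}]\ge c\,m\qquad\text{for all } m\in\mathbb{N},\ m\ge 1. \] Moreover, if $\mathcal{X}$ is total, then this basis $\mathcal{B}$ is total. -/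

import Mathlib

open Filter Topology
open scoped ENNReal

/-! ### Quasi-Banach spaces over the real or complex field -/

section QuasiBanach

variable (𝕜 : Type*) [RCLike 𝕜]
variable {X : Type*} [AddCommGroup X] [Module 𝕜 X]
variable {Y : Type*} [AddCommGroup Y] [Module 𝕜 Y]

/-- `q` is a quasi-norm on the `𝕜`-vector space `X`. -/
structure IsQuasiNorm (q : X → ℝ) : Prop where
  nonneg : ∀ f, 0 ≤ q f
  eq_zero_iff : ∀ f, q f = 0 ↔ f = 0
  smul : ∀ (a : 𝕜) (f : X), q (a • f) = ‖a‖ * q f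
  add_le : ∃ κ : ℝ, 1 ≤ κ ∧ ∀ f g, q (f + g) ≤ κ * (q f + q g)

/-- `(X, q)` is a quasi-Banach space: `q` is a quasi-norm on `X`, and every sequence in `X` which is
Cauchy with respect to `q` converges with respect to `q`. -/
structure IsQuasiBanach (q : X → ℝ) : Prop extends IsQuasiNorm 𝕜 q where
  complete : ∀ u : ℕ → X,
    (∀ ε : ℝ, 0 < ε → ∃ N : ℕ, ∀ m n : ℕ, N ≤ m → N ≤ n → q (u m - u n) < ε) →
      ∃ f : X, Tendsto (fun n => q (u n - f)) atTop (𝓝 0)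

/-- The vector topology defined by the quasi-norm `q` is locally convex: each ball centred at the
origin contains a convex neighbourhood of the origin. -/
def IsLocallyConvexQuasiNorm {X : Type*} [AddCommGroup X] [Module ℝ X] (q : X → ℝ) : Prop :=
  ∀ ε : ℝ, 0 < ε → ∃ U : Set X, Convex ℝ U ∧
    (∃ δ : ℝ, 0 < δ ∧ ∀ f, q f < δ → f ∈ U) ∧ ∀ f ∈ U, q f < ε

variable {𝕜}

/-- Boundedness (equivalently, continuity) of a linear operator from `(X, q)` to `(Y, r)`. -/
def IsBoundedOperator (q : X → ℝ) (r : Y → ℝ) (T : X →ₗ[𝕜] Y) : Prop :=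
  ∃ C : ℝ, ∀ f, r (T f) ≤ C * q f

/-- The norm of a linear functional on `(X, q)`; it is finite exactly when the functional is
bounded. -/
noncomputable def functionalNorm (q : X → ℝ) (φ : X →ₗ[𝕜] 𝕜) : ℝ≥0∞ :=
  ⨆ (f : X) (_ : q f ≤ 1), ENNReal.ofReal ‖φ f‖

/-- The subspace `V` is dense in `(X, q)`. -/
def IsDenseSubspace (q : X → ℝ) (V : Submodule 𝕜 X) : Prop :=
  ∀ f : X, ∀ ε : ℝ, 0 < ε → ∃ g ∈ V, q (f - g) < ε

variable (𝕜)

/-- `(Y, r)` is complemented in `(X, q)`: there is an isomorphic embedding `J` of `Y` into `X` whose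
range is the range of a bounded linear projection `P` of `X`. -/
def IsComplementedIn (r : Y → ℝ) (q : X → ℝ) : Prop :=
  ∃ (J : Y →ₗ[𝕜] X) (P : X →ₗ[𝕜] X),
    IsBoundedOperator r q J ∧ (∃ c : ℝ, 0 < c ∧ ∀ g, c * r g ≤ q (J g)) ∧
    IsBoundedOperator q q P ∧ P ∘ₗ P = P ∧ LinearMap.range P = LinearMap.range J

/-! ### Bases -/

/-- A basis of the quasi-Banach space `(X, q)`: a sequence `vec` whose linear span is dense in `X`,
together with its (unique) sequence `dual` of biorthogonal bounded linear functionals. Sequences are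
indexed from `0`. -/
structure SpaceBasis (q : X → ℝ) where
  vec : ℕ → X
  dual : ℕ → X →ₗ[𝕜] 𝕜
  dense_span : IsDenseSubspace q (Submodule.span 𝕜 (Set.range vec))
  dual_bounded : ∀ n, IsBoundedOperator q (fun a : 𝕜 => ‖a‖) (dual n)
  biorthogonal : ∀ n k, dual n (vec k) = if k = n then 1 else 0

namespace SpaceBasis

variable {𝕜} {q : X → ℝ}

/-- The basis is total: its coefficient transform is one-to-one. -/
def IsTotal (B : SpaceBasis 𝕜 q) : Prop :=
  Function.Injective fun (f : X) (n : ℕ) => B.dual n f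

/-- The basis is `M`-bounded: `sup_n ‖x_n‖ ‖x_n^*‖ < ∞`. -/
def IsMBounded (B : SpaceBasis 𝕜 q) : Prop :=
  (⨆ n, ENNReal.ofReal (q (B.vec n)) * functionalNorm q (B.dual n)) < ∞

/-- The coordinate projection `S_A` of the basis on a finite set `A`. -/
noncomputable def coordProj (B : SpaceBasis 𝕜 q) (A : Finset ℕ) (f : X) : X :=
  ∑ n ∈ A, B.dual n f • B.vec n

/-- The parameter `k̃_m`: the supremum of `‖S_A(f)‖` over all vectors `f` of the closed unit ball
which lie in the span of the first `m` vectors of the basis, and all finite sets `A`. -/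
noncomputable def kTilde (B : SpaceBasis 𝕜 q) (m : ℕ) : ℝ≥0∞ :=
  ⨆ (f : X) (_ : q f ≤ 1) (_ : f ∈ Submodule.span 𝕜 (B.vec '' {j | j < m})) (A : Finset ℕ),
    ENNReal.ofReal (q (B.coordProj A f))

/-- The basis is `1`-symmetric: changing the signs (the unimodular factors) of the coefficients of a
finite linear combination and permuting the basis leaves its quasi-norm unchanged. -/
def IsOneSymmetric (B : SpaceBasis 𝕜 q) : Prop :=
  ∀ (a : ℕ →₀ 𝕜) (ε : ℕ → 𝕜) (π : Equiv.Perm ℕ), (∀ n, ‖ε n‖ = 1) →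
    q (∑ n ∈ a.support, (ε n * a n) • B.vec (π n)) = q (∑ n ∈ a.support, a n • B.vec n)

end SpaceBasis

/-! ### Sequence spaces -/

/-- A sequence space: a quasi-Banach space of scalar sequences which contains the finitely supported
sequences as a dense subspace and on which the coordinate functionals are bounded. -/
structure SequenceSpace where
  carrier : Submodule 𝕜 (ℕ → 𝕜)
  qnorm : carrier → ℝ
  isQuasiBanach : IsQuasiBanach 𝕜 qnorm
  single_mem : ∀ n, (Pi.single n (1 : 𝕜) : ℕ → 𝕜) ∈ carrier
  dense_span : IsDenseSubspace qnorm
    (Submodule.span 𝕜 (Set.range fun n => (⟨Pi.single n 1, single_mem n⟩ : carrier)))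
  coord_bounded : ∀ n,
    IsBoundedOperator qnorm (fun a : 𝕜 => ‖a‖) (LinearMap.proj n ∘ₗ carrier.subtype)

namespace SequenceSpace

variable {𝕜}

/-- The unit vector system of a sequence space, with the coordinate functionals as its dual
basis. -/
def unitBasis (S : SequenceSpace 𝕜) : SpaceBasis 𝕜 S.qnorm where
  vec n := ⟨Pi.single n 1, S.single_mem n⟩
  dual n := LinearMap.proj n ∘ₗ S.carrier.subtype
  dense_span := S.dense_span
  dual_bounded := S.coord_bounded
  biorthogonal n k := by
    simp [Pi.single_apply, eq_comm]

/-- A symmetric sequence space: its unit vector system is a `1`-symmetric basis. -/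
def IsSymmetric (S : SequenceSpace 𝕜) : Prop := S.unitBasis.IsOneSymmetric

end SequenceSpace

end QuasiBanach

/-!
The new basis is obtained from a system on `X ⊕ S` by a change of basis in finite blocks of unit
vectors of `S`, the sizes of which grow geometrically.

*Absorbing a copy of `S`.* Since `S` is symmetric, spreading sequences along an injection of `ℕ`
and passing to a subsequence of the coordinates are bounded on `S`. Hence `S` is isomorphic to the
sum of its even and odd parts, and `X` to `X ⊕ S`: the given basis, together with the unit vectors
of the odd part, yields an `M`-bounded system of `X` (`exists_system_of_complemented`).

*Averaging.* Local convexity enters only through the averaging projections of `S` on finite sets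
`F`: a mean over the cyclic permutations of `F` shows that `‖∑_{k ∈ F} e_k‖ ‖∑_{k ∈ F} e_k^*‖` is
at most a multiple of the number of elements of `F`
(`SequenceSpace.IsSymmetric.exists_averaging_bound`).

*The block.* Take unit vectors `e_j` and `g_j` (`1 ≤ j ≤ N`), `f` and `h`, with means `ē` and `ḡ`
of the two families, and signs `ε_j` with sum zero. Put
`x_j = e_j - ē + f / N + ε_j h` and `z_i = g_i - ḡ + h`, and add the vectors `∑ e_j` and `∑ g_j`.
The biorthogonal functionals are
`x_j^* = e_j^* - (∑ e_k^*) / N + f^*` and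
`z_i^* = g_i^* - (∑ g_k^*) / N + (h^* - ∑ ε_k e_k^*) / N`, together with the means of the `e_j^*`
and of the `g_j^*`. By the averaging estimate this block is `M`-bounded uniformly in `N`
(`qnorm_blockVec_mul_le`); it spans the same space as the old block, and so do its functionals.
All vectors `x_j` have a component `± h` and all functionals `x_j^*` have the component `f^*`. As a
consequence `∑ x_j = f` is bounded, whereas the sum of the `x_j` with `ε_j = 1` has the coefficient
`N / 2` at `h`, which makes its quasi-norm at least a multiple of `N`.

*Enumeration.* The `k`-th block has `N = 2 ^ (k + 1)` and is placed among the first `2 ^ (k + 4)`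
terms of the basis, the images of the vectors of the old basis filling the remaining places
(`exists_equiv_sigma_sum_nat`). So the first `m` terms contain a block of size comparable to `m`.
-/

/-! ### Quasi-norms -/

section QuasiNorm

variable {𝕜 : Type*} [RCLike 𝕜] {X : Type*} [AddCommGroup X] [Module 𝕜 X] {q : X → ℝ}

namespace IsQuasiNorm

theorem map_zero (hq : IsQuasiNorm 𝕜 q) : q 0 = 0 := (hq.eq_zero_iff 0).2 rfl

theorem map_neg (hq : IsQuasiNorm 𝕜 q) (f : X) : q (-f) = q f := by
  simpa using hq.smul (-1) f

theorem pos (hq : IsQuasiNorm 𝕜 q) {f : X} (hf : f ≠ 0) : 0 < q f :=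
  lt_of_le_of_ne (hq.nonneg f) fun h => hf ((hq.eq_zero_iff f).1 h.symm)

/-- A homogeneous estimate holds everywhere once it holds on the unit sphere. -/
theorem norm_apply_le (hq : IsQuasiNorm 𝕜 q) {φ : X →ₗ[𝕜] 𝕜} {K : ℝ}
    (h : ∀ f, q f = 1 → ‖φ f‖ ≤ K) (f : X) : ‖φ f‖ ≤ K * q f := by
  by_cases hf : f = 0
  · simp [hf, hq.map_zero]
  have hpos := hq.pos hf
  have := h ((((q f)⁻¹ : ℝ) : 𝕜) • f) (by
    rw [hq.smul, RCLike.norm_ofReal, abs_of_pos (inv_pos.2 hpos), inv_mul_cancel₀ hpos.ne'])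
  rw [map_smul, norm_smul, RCLike.norm_ofReal, abs_of_pos (inv_pos.2 hpos)] at this
  rwa [inv_mul_le_iff₀ hpos, mul_comm] at this

end IsQuasiNorm

namespace SpaceBasis

theorem vec_ne_zero (B : SpaceBasis 𝕜 q) (n : ℕ) : B.vec n ≠ 0 := fun h => by
  have := B.biorthogonal n n
  simp [h] at this

theorem IsMBounded.exists_bound (hq : IsQuasiNorm 𝕜 q) {B : SpaceBasis 𝕜 q}
    (hB : B.IsMBounded) :
    ∃ C : ℝ, 0 ≤ C ∧ ∀ n f, q (B.vec n) * ‖B.dual n f‖ ≤ C * q f := by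
  unfold IsMBounded at hB
  refine ⟨(⨆ n, ENNReal.ofReal (q (B.vec n)) * functionalNorm q (B.dual n)).toReal,
    ENNReal.toReal_nonneg, fun n f => ?_⟩
  have hpos : 0 < q (B.vec n) := hq.pos (B.vec_ne_zero n)
  have := hq.norm_apply_le (φ := B.dual n)
    (K := (q (B.vec n))⁻¹ * ENNReal.toReal
      (⨆ n, ENNReal.ofReal (q (B.vec n)) * functionalNorm q (B.dual n))) (fun g hg => ?_) f
  · rwa [mul_assoc, ← div_eq_inv_mul, le_div_iff₀ hpos, mul_comm] at this
  · rw [← div_eq_inv_mul, le_div_iff₀ hpos, mul_comm]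
    rw [← ENNReal.ofReal_le_iff_le_toReal hB.ne, ENNReal.ofReal_mul hpos.le]
    refine le_trans ?_
      (le_iSup (fun n => ENNReal.ofReal (q (B.vec n)) * functionalNorm q (B.dual n)) n)
    refine mul_le_mul_right ?_ _
    exact le_iSup₂_of_le (f := fun (f : X) (_ : q f ≤ 1) => ENNReal.ofReal ‖B.dual n f‖)
      g hg.le le_rfl

theorem isMBounded_of_bound (hq : IsQuasiNorm 𝕜 q) {B : SpaceBasis 𝕜 q} {C : ℝ} (hC : 0 ≤ C)
    (h : ∀ n f, q (B.vec n) * ‖B.dual n f‖ ≤ C * q f) : B.IsMBounded := by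
  refine lt_of_le_of_lt (iSup_le fun n => ?_) (ENNReal.ofReal_lt_top (r := C))
  unfold functionalNorm
  rw [ENNReal.mul_iSup]
  refine iSup_le fun f => ?_
  rw [ENNReal.mul_iSup]
  refine iSup_le fun hf => ?_
  rw [← ENNReal.ofReal_mul (hq.nonneg _)]
  exact ENNReal.ofReal_le_ofReal ((h n f).trans (mul_le_of_le_one_right hC hf))

end SpaceBasis

/-- In a locally convex quasi-normed space, means of vectors are controlled by the largest of their
quasi-norms. -/
theorem IsLocallyConvexQuasiNorm.exists_sum_le [Module ℝ X] [IsScalarTower ℝ 𝕜 X]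
    (hq : IsQuasiNorm 𝕜 q) (hconv : IsLocallyConvexQuasiNorm q) :
    ∃ K : ℝ, 0 ≤ K ∧ ∀ (N : ℕ) (f : Fin N → X) (t : ℝ), (∀ r, q (f r) ≤ t) →
      q (∑ r, f r) ≤ K * N * t := by
  obtain ⟨U, hU, ⟨δ, hδ, hδU⟩, hU1⟩ := hconv 1 one_pos
  refine ⟨2 / δ, by positivity, fun N f t hf => ?_⟩
  rcases Nat.eq_zero_or_pos N with rfl | hN
  · simp [hq.map_zero]
  have ht0 : 0 ≤ t := (hq.nonneg _).trans (hf ⟨0, hN⟩)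
  rcases ht0.eq_or_lt with rfl | ht
  · have : ∀ r, f r = 0 := fun r => (hq.eq_zero_iff _).1 (le_antisymm (hf r) (hq.nonneg _))
    simp [this, hq.map_zero]
  have hN' : (0 : ℝ) < N := by exact_mod_cast hN
  have hs : 0 < δ / (2 * t) := by positivity
  have hreal : ∀ (c : ℝ) (g : X), 0 < c → q (c • g) = c * q g := fun c g hc => by
    rw [RCLike.real_smul_eq_coe_smul (K := 𝕜), hq.smul, RCLike.norm_ofReal, abs_of_pos hc]
  have hmem : ∑ r : Fin N, (1 / N : ℝ) • ((δ / (2 * t)) • f r) ∈ U := by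
    refine hU.sum_mem (fun _ _ => by positivity) ?_ fun r _ => hδU _ ?_
    · simp [hN'.ne']
    · rw [hreal _ _ hs]
      calc δ / (2 * t) * q (f r) ≤ δ / (2 * t) * t := by gcongr; exact hf r
        _ = δ / 2 := by field_simp
        _ < δ := by linarith
  have := hU1 _ hmem
  rw [← Finset.smul_sum, ← Finset.smul_sum, hreal _ _ (by positivity), hreal _ _ hs] at this
  have h2 : q (∑ r, f r) = (2 / δ * N * t) * (1 / N * (δ / (2 * t) * q (∑ r, f r))) := by
    field_simp
  rw [h2]
  exact mul_le_of_le_one_right (by positivity) this.le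

end QuasiNorm

/-! ### Operators on symmetric sequence spaces -/

namespace SequenceSpace

variable {𝕜 : Type*} [RCLike 𝕜] (S : SequenceSpace 𝕜)

/-- The `n`-th unit vector of the sequence space. -/
noncomputable def unit (n : ℕ) : S.carrier := S.unitBasis.vec n

theorem coe_unit (n : ℕ) : (S.unit n : ℕ → 𝕜) = Pi.single n 1 := rfl

theorem unit_apply (n k : ℕ) : (S.unit n : ℕ → 𝕜) k = if k = n then 1 else 0 := by
  rw [coe_unit, Pi.single_apply]

theorem unit_ne_zero (n : ℕ) : S.unit n ≠ 0 := S.unitBasis.vec_ne_zero n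

theorem exists_eq_sum_of_mem_span {g : S.carrier} (hg : g ∈ Submodule.span 𝕜 (Set.range S.unit)) :
    ∃ s : Finset ℕ, ∀ t, s ⊆ t → g = ∑ n ∈ t, (g : ℕ → 𝕜) n • S.unit n := by
  obtain ⟨c, rfl⟩ := Finsupp.mem_span_range_iff_exists_finsupp.1 hg
  refine ⟨c.support, fun t ht => ?_⟩
  have hc : ∀ n, ((c.sum fun i a => a • S.unit i : S.carrier) : ℕ → 𝕜) n = c n := fun n => by
    simp +contextual [Finsupp.sum, unit_apply, Finset.sum_apply, eq_comm]
  simp_rw [hc]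
  exact Finsupp.sum_of_support_subset c ht _ (by simp)

/-- A linear map of sequences, with coordinates bounded on `S`, which is bounded on the finitely
supported sequences maps `S` boundedly into itself. -/
theorem exists_mem_of_bounded_on_span {κ : ℝ} (hκ0 : 0 ≤ κ)
    (hκ : ∀ f g, S.qnorm (f + g) ≤ κ * (S.qnorm f + S.qnorm g))
    (L : (ℕ → 𝕜) →ₗ[𝕜] (ℕ → 𝕜)) {C : ℝ} (hC : 0 ≤ C)
    (hcoord : ∀ n, ∃ K : ℝ, ∀ f : S.carrier, ‖L f n‖ ≤ K * S.qnorm f)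
    (hfin : ∀ g ∈ Submodule.span 𝕜 (Set.range S.unit),
      ∃ h : L g ∈ S.carrier, S.qnorm ⟨L g, h⟩ ≤ C * S.qnorm g) (f : S.carrier) :
    ∃ h : L f ∈ S.carrier, S.qnorm ⟨L f, h⟩ ≤ κ * C * κ * S.qnorm f := by
  have hq := S.isQuasiBanach.toIsQuasiNorm
  choose g hgV hgf using fun k : ℕ => S.dense_span f (1 / ((k : ℝ) + 1)) (by positivity)
  have hgV' : ∀ k, g k ∈ Submodule.span 𝕜 (Set.range S.unit) := hgV
  have hlim : Tendsto (fun k => S.qnorm (f - g k)) atTop (𝓝 0) :=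
    squeeze_zero (fun _ => hq.nonneg _) (fun k => (hgf k).le)
      tendsto_one_div_add_atTop_nhds_zero_nat
  choose hmem hbd using fun k => hfin (g k) (hgV' k)
  -- The images of the approximants form a Cauchy sequence.
  obtain ⟨h, hh⟩ := S.isQuasiBanach.complete (fun k => ⟨L (g k), hmem k⟩) (by
    intro ε hε
    have hδ : 0 < ε / (C * κ * 2 + 1) := by positivity
    obtain ⟨N, hN⟩ := eventually_atTop.1 (hlim.eventually (gt_mem_nhds hδ))
    refine ⟨N, fun m n hm hn => ?_⟩
    obtain ⟨h1, h2⟩ := hfin (g m - g n) (Submodule.sub_mem _ (hgV' m) (hgV' n))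
    have e1 : (⟨L (g m), hmem m⟩ - ⟨L (g n), hmem n⟩ : S.carrier)
        = ⟨L ((g m - g n : S.carrier) : ℕ → 𝕜), h1⟩ := Subtype.ext (by simp)
    have e2 : g m - g n = (f - g n) + -(f - g m) := by abel
    have h3 := hκ (f - g n) (-(f - g m))
    rw [hq.map_neg, ← e2] at h3
    show S.qnorm (⟨L (g m), hmem m⟩ - ⟨L (g n), hmem n⟩) < ε
    rw [e1]
    have hd : (C * κ * 2 + 1) * (ε / (C * κ * 2 + 1)) = ε := by field_simp
    have h4 : κ * (S.qnorm (f - g n) + S.qnorm (f - g m)) ≤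
        κ * (2 * (ε / (C * κ * 2 + 1))) :=
      mul_le_mul_of_nonneg_left (by linarith [hN n hn, hN m hm]) hκ0
    nlinarith [mul_le_mul_of_nonneg_left (h3.trans h4) hC])
  have hval : (h : ℕ → 𝕜) = L f := by
    funext n
    obtain ⟨K, hK⟩ := hcoord n
    obtain ⟨K', hK'⟩ := S.coord_bounded n
    have t1 : Tendsto (fun k => L (g k) n) atTop (𝓝 (L f n)) := by
      rw [tendsto_iff_norm_sub_tendsto_zero]
      refine squeeze_zero (fun _ => norm_nonneg _) (fun k => ?_) (by simpa using hlim.const_mul K)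
      rw [norm_sub_rev]
      simpa using hK (f - g k)
    have t2 : Tendsto (fun k => L (g k) n) atTop (𝓝 ((h : ℕ → 𝕜) n)) := by
      rw [tendsto_iff_norm_sub_tendsto_zero]
      refine squeeze_zero (fun _ => norm_nonneg _) (fun k => ?_) (by simpa using hh.const_mul K')
      simpa using hK' (⟨L (g k), hmem k⟩ - h)
    exact tendsto_nhds_unique t2 t1
  have hm : L f ∈ S.carrier := hval ▸ h.2
  refine ⟨hm, ?_⟩
  have hfh : (⟨L f, hm⟩ : S.carrier) = h := Subtype.ext hval.symm
  rw [hfh]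
  refine ge_of_tendsto (x := atTop) (f := fun k => κ * (S.qnorm (⟨L (g k), hmem k⟩ - h) +
    C * (κ * (S.qnorm f + S.qnorm (f - g k))))) ?_ (Eventually.of_forall fun k => ?_)
  · have := (hh.add (((hlim.const_add (S.qnorm f)).const_mul κ).const_mul C)).const_mul κ
    convert this using 2
    ring
  · have h1 := hκ (-(⟨L (g k), hmem k⟩ - h)) ⟨L (g k), hmem k⟩
    rw [hq.map_neg] at h1
    have e1 : -((⟨L (g k), hmem k⟩ : S.carrier) - h) + ⟨L (g k), hmem k⟩ = h := by abel
    rw [e1] at h1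
    have h2 := hκ f (-(f - g k))
    rw [hq.map_neg] at h2
    have e2 : f + -(f - g k) = g k := by abel
    rw [e2] at h2
    refine h1.trans (mul_le_mul_of_nonneg_left ?_ hκ0)
    exact add_le_add le_rfl ((hbd k).trans (mul_le_mul_of_nonneg_left h2 hC))

variable {S}

/-- Invariance of the quasi-norm under rearrangements and unimodular factors, for finite families
of unit vectors. -/
theorem IsSymmetric.qnorm_sum (hS : S.IsSymmetric) {ι : Type*} [Fintype ι] {φ ψ : ι → ℕ}
    (hφ : φ.Injective) (hψ : ψ.Injective) (a ε : ι → 𝕜) (hε : ∀ i, ‖ε i‖ = 1) :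
    S.qnorm (∑ i, (ε i * a i) • S.unit (ψ i)) = S.qnorm (∑ i, a i • S.unit (φ i)) := by
  obtain ⟨π, hπ⟩ := Equiv.Perm.exists_extending_pair φ ψ hφ hψ
  have key := hS (Finsupp.embDomain ⟨φ, hφ⟩ (Finsupp.equivFunOnFinite.symm a))
    (Function.extend φ ε 1) π (fun n => by
      by_cases hn : ∃ i, φ i = n
      · obtain ⟨i, rfl⟩ := hn
        rw [hφ.extend_apply, hε]
      · rw [Function.extend_apply' _ _ _ hn]; simp)
  have e1 := Finsupp.sum_embDomain (v := Finsupp.equivFunOnFinite.symm a) (f := ⟨φ, hφ⟩)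
    (g := fun n x => (Function.extend φ ε 1 n * x) • S.unitBasis.vec (π n))
  have e2 := Finsupp.sum_embDomain (v := Finsupp.equivFunOnFinite.symm a) (f := ⟨φ, hφ⟩)
    (g := fun n x => x • S.unitBasis.vec n)
  rw [Finsupp.sum_fintype (Finsupp.equivFunOnFinite.symm a) _ (by simp), Finsupp.sum] at e1 e2
  rw [e1, e2] at key
  simpa [hφ.extend_apply, hπ, unit] using key

theorem IsSymmetric.qnorm_unit (hS : S.IsSymmetric) (m n : ℕ) :
    S.qnorm (S.unit m) = S.qnorm (S.unit n) := by
  simpa using hS.qnorm_sum (ι := Unit) (φ := fun _ => n) (ψ := fun _ => m)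
    (Function.injective_of_subsingleton _) (Function.injective_of_subsingleton _) 1 1 (by simp)

/-- Suppression of coordinates: the restriction is the mean of the vector and of the vector with
the signs of the other coordinates changed. -/
theorem IsSymmetric.qnorm_sum_subset (hS : S.IsSymmetric) {κ : ℝ}
    (hκ : ∀ f g, S.qnorm (f + g) ≤ κ * (S.qnorm f + S.qnorm g)) {s t : Finset ℕ} (hts : t ⊆ s)
    (a : ℕ → 𝕜) :
    S.qnorm (∑ n ∈ t, a n • S.unit n) ≤ κ * S.qnorm (∑ n ∈ s, a n • S.unit n) := by
  have hq := S.isQuasiBanach.toIsQuasiNorm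
  have h1 := hS.qnorm_sum (ι := s) (φ := Subtype.val) (ψ := Subtype.val) Subtype.val_injective
    Subtype.val_injective (fun i => a i) (fun i => if i.1 ∈ t then 1 else -1)
    (fun i => by split_ifs <;> simp)
  rw [Finset.sum_coe_sort s (fun n => a n • S.unit n),
    Finset.sum_coe_sort s (fun n => ((if n ∈ t then 1 else -1) * a n) • S.unit n)] at h1
  have h2 : (∑ n ∈ s, a n • S.unit n) + (∑ n ∈ s, ((if n ∈ t then 1 else -1) * a n) • S.unit n)
      = (2 : 𝕜) • ∑ n ∈ t, a n • S.unit n := by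
    have h4 : ∑ n ∈ t, (2 : 𝕜) • a n • S.unit n
        = ∑ n ∈ s, if n ∈ t then (2 : 𝕜) • a n • S.unit n else 0 := by
      rw [Finset.sum_ite_mem, Finset.inter_eq_right.2 hts]
    rw [← Finset.sum_add_distrib, Finset.smul_sum, h4]
    refine Finset.sum_congr rfl fun n _ => ?_
    by_cases hnt : n ∈ t
    · simp [hnt, two_smul]
    · simp only [hnt, if_false]
      module
  have h3 := hκ (∑ n ∈ s, a n • S.unit n) (∑ n ∈ s, ((if n ∈ t then 1 else -1) * a n) • S.unit n)
  rw [h2, h1, hq.smul, RCLike.norm_ofNat] at h3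
  linarith

/-- Spreading a sequence along an injection acts boundedly on a symmetric sequence space. -/
theorem IsSymmetric.exists_extend (hS : S.IsSymmetric) {φ : ℕ → ℕ} (hφ : φ.Injective) :
    ∃ D : S.carrier →ₗ[𝕜] S.carrier, IsBoundedOperator S.qnorm S.qnorm D ∧
      ∀ f : S.carrier, (D f : ℕ → 𝕜) = Function.extend φ f 0 := by
  have hq := S.isQuasiBanach.toIsQuasiNorm
  obtain ⟨κ, hκ1, hκ⟩ := hq.add_le
  have hext := S.exists_mem_of_bounded_on_span (by linarith) hκ
    (Function.ExtendByZero.linearMap 𝕜 φ) (C := 1) zero_le_one (fun n => by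
      by_cases hn : ∃ i, φ i = n
      · obtain ⟨i, rfl⟩ := hn
        obtain ⟨K, hK⟩ := S.coord_bounded i
        exact ⟨K, fun f => by simpa [hφ.extend_apply] using hK f⟩
      · exact ⟨0, fun f => by simp [Function.extend_apply' _ _ _ hn]⟩) (fun g hg => by
      obtain ⟨s, hs⟩ := S.exists_eq_sum_of_mem_span hg
      have hs := hs s subset_rfl
      have e : Function.ExtendByZero.linearMap 𝕜 φ (g : ℕ → 𝕜)
          = ((∑ n ∈ s, (g : ℕ → 𝕜) n • S.unit (φ n) : S.carrier) : ℕ → 𝕜) := by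
        conv_lhs => rw [hs]
        simp only [Submodule.coe_sum, Submodule.coe_smul, map_sum, map_smul, coe_unit]
        refine Finset.sum_congr rfl fun n _ => ?_
        congr 1
        funext k
        by_cases hk : ∃ i, φ i = k
        · obtain ⟨i, rfl⟩ := hk
          simp [hφ.extend_apply, Pi.single_apply, hφ.eq_iff]
        · have : k ≠ φ n := fun h => hk ⟨n, h.symm⟩
          simp [Function.extend_apply' _ _ _ hk, this]
      refine ⟨e ▸ Subtype.property _, ?_⟩
      have h1 := hS.qnorm_sum (ι := s) (φ := Subtype.val) (ψ := fun i => φ i.1)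
        Subtype.val_injective (hφ.comp Subtype.val_injective) (fun i => (g : ℕ → 𝕜) i) 1 (by simp)
      simp only [Pi.one_apply, one_mul] at h1
      rw [Finset.sum_coe_sort s (fun n => (g : ℕ → 𝕜) n • S.unit n),
        Finset.sum_coe_sort s (fun n => (g : ℕ → 𝕜) n • S.unit (φ n)), ← hs] at h1
      rw [one_mul, ← h1]
      exact le_of_eq (congrArg S.qnorm (Subtype.ext e)))
  choose hmem hbd using hext
  exact ⟨(Function.ExtendByZero.linearMap 𝕜 φ).restrict fun f hf => hmem ⟨f, hf⟩,
    ⟨_, hbd⟩, fun f => rfl⟩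

/-- Passing to a subsequence of the coordinates acts boundedly on a symmetric sequence space. -/
theorem IsSymmetric.exists_comp (hS : S.IsSymmetric) {φ : ℕ → ℕ} (hφ : φ.Injective) :
    ∃ R : S.carrier →ₗ[𝕜] S.carrier, IsBoundedOperator S.qnorm S.qnorm R ∧
      ∀ f : S.carrier, (R f : ℕ → 𝕜) = (f : ℕ → 𝕜) ∘ φ := by
  have hq := S.isQuasiBanach.toIsQuasiNorm
  obtain ⟨κ, hκ1, hκ⟩ := hq.add_le
  have hext := S.exists_mem_of_bounded_on_span (by linarith) hκ
    (LinearMap.funLeft 𝕜 𝕜 φ) (C := κ) (by linarith) (fun n => by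
      obtain ⟨K, hK⟩ := S.coord_bounded (φ n)
      exact ⟨K, fun f => by simpa using hK f⟩) (fun g hg => by
      obtain ⟨s, hs⟩ := S.exists_eq_sum_of_mem_span hg
      have hs := hs s subset_rfl
      set t := s.preimage φ hφ.injOn with ht
      have e : LinearMap.funLeft 𝕜 𝕜 φ (g : ℕ → 𝕜)
          = ((∑ n ∈ t, (g : ℕ → 𝕜) (φ n) • S.unit n : S.carrier) : ℕ → 𝕜) := by
        funext k
        have h0 : (g : ℕ → 𝕜) (φ k) = if φ k ∈ s then (g : ℕ → 𝕜) (φ k) else 0 := by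
          conv_lhs => rw [hs]
          simp [unit_apply, Finset.sum_apply]
        rw [LinearMap.funLeft_apply, h0]
        simp [unit_apply, Finset.sum_apply, ht]
      refine ⟨e ▸ Subtype.property _, ?_⟩
      have h1 := hS.qnorm_sum (ι := t) (ψ := Subtype.val) (φ := fun i => φ i.1)
        (hφ.comp Subtype.val_injective) Subtype.val_injective (fun i => (g : ℕ → 𝕜) (φ i)) 1
        (by simp)
      simp only [Pi.one_apply, one_mul] at h1
      rw [Finset.sum_coe_sort t (fun n => (g : ℕ → 𝕜) (φ n) • S.unit n),
        Finset.sum_coe_sort t (fun n => (g : ℕ → 𝕜) (φ n) • S.unit (φ n)),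
        show ∑ n ∈ t, (g : ℕ → 𝕜) (φ n) • S.unit (φ n)
          = ∑ n ∈ t.map ⟨φ, hφ⟩, (g : ℕ → 𝕜) n • S.unit n from
          (Finset.sum_map t ⟨φ, hφ⟩ (fun n => (g : ℕ → 𝕜) n • S.unit n)).symm] at h1
      have h2 := hS.qnorm_sum_subset hκ (s := s) (t := t.map ⟨φ, hφ⟩) (by
        intro n hn
        obtain ⟨k, hk, rfl⟩ := Finset.mem_map.1 hn
        exact Finset.mem_preimage.1 hk) (g : ℕ → 𝕜)
      rw [← h1, ← hs] at h2
      exact (congrArg S.qnorm (Subtype.ext e)).trans_le h2)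
  choose hmem hbd using hext
  exact ⟨(LinearMap.funLeft 𝕜 𝕜 φ).restrict fun f hf => hmem ⟨f, hf⟩, ⟨_, hbd⟩, fun f => rfl⟩

/-- In a locally convex symmetric sequence space the averaging projections are uniformly bounded:
on vectors supported by `F` they are means over cyclic permutations of `F`. -/
theorem IsSymmetric.exists_averaging_bound (hS : S.IsSymmetric)
    (hconv : IsLocallyConvexQuasiNorm S.qnorm) :
    ∃ C : ℝ, 0 ≤ C ∧ ∀ (F : Finset ℕ) (f : S.carrier),
      S.qnorm (∑ k ∈ F, S.unit k) * ‖∑ k ∈ F, (f : ℕ → 𝕜) k‖ ≤ C * F.card * S.qnorm f := by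
  have hq := S.isQuasiBanach.toIsQuasiNorm
  obtain ⟨κ, hκ1, hκ⟩ := hq.add_le
  have hκ0 : 0 ≤ κ := by linarith
  obtain ⟨K, hK0, hK⟩ := hconv.exists_sum_le (𝕜 := 𝕜) hq
  refine ⟨κ * (K * κ) * κ, by positivity, fun F f => ?_⟩
  let σ : (ℕ → 𝕜) →ₗ[𝕜] 𝕜 := ∑ k ∈ F, LinearMap.proj k
  have hσ : ∀ g, σ g = ∑ k ∈ F, g k := fun g => by simp [σ]
  let w : S.carrier := ∑ k ∈ F, S.unit k
  have hσb : ∃ K : ℝ, ∀ f : S.carrier, ‖σ f‖ ≤ K * S.qnorm f := by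
    choose k hk using S.coord_bounded
    refine ⟨∑ n ∈ F, k n, fun f => ?_⟩
    rw [hσ, Finset.sum_mul]
    exact norm_sum_le_of_le _ fun n _ => hk n f
  obtain ⟨Kσ, hKσ⟩ := hσb
  obtain ⟨h, hb⟩ := S.exists_mem_of_bounded_on_span hκ0 hκ (σ.smulRight (w : ℕ → 𝕜))
    (C := K * F.card * κ) (by positivity) (fun n => ⟨‖(w : ℕ → 𝕜) n‖ * Kσ, fun f => by
      rw [LinearMap.smulRight_apply, Pi.smul_apply, smul_eq_mul, norm_mul, mul_comm, mul_assoc]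
      exact mul_le_mul_of_nonneg_left (hKσ f) (norm_nonneg _)⟩) (fun g hg => by
      refine ⟨S.carrier.smul_mem _ w.2, ?_⟩
      obtain ⟨s, hs⟩ := S.exists_eq_sum_of_mem_span hg
      have hs := hs (F ∪ s) Finset.subset_union_right
      have h1 := hS.qnorm_sum_subset hκ (Finset.subset_union_left (s₁ := F) (s₂ := s)) (g : ℕ → 𝕜)
      rw [← hs] at h1
      obtain ⟨N, hN⟩ : ∃ N, F.card = N := ⟨_, rfl⟩
      rw [hN]
      rcases Nat.eq_zero_or_pos N with rfl | hNpos
      · have : F = ∅ := Finset.card_eq_zero.1 hN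
        have e : (⟨σ.smulRight (w : ℕ → 𝕜) g, S.carrier.smul_mem _ w.2⟩ : S.carrier) = 0 :=
          Subtype.ext (by simp [w, this])
        rw [e, hq.map_zero]
        simp
      have : NeZero N := ⟨hNpos.ne'⟩
      let e := F.orderIsoOfFin hN
      have hinj : Function.Injective fun i => (e i : ℕ) :=
        Subtype.val_injective.comp e.injective
      have hsum : ∀ {M : Type _} [AddCommMonoid M] (G : ℕ → M), ∑ i, G (e i) = ∑ k ∈ F, G k := by
        intro M _ G
        rw [← Finset.sum_coe_sort F G]
        exact e.toEquiv.sum_comp (fun k => G k)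
      have h2 : ∀ r : Fin N, S.qnorm (∑ i, (g : ℕ → 𝕜) (e i) • S.unit (e (i + r)))
          ≤ κ * S.qnorm g := fun r => by
        have := hS.qnorm_sum hinj (hinj.comp (add_left_injective r)) (fun i => (g : ℕ → 𝕜) (e i)) 1
          (by simp)
        simp only [Pi.one_apply, one_mul, Function.comp] at this
        rw [this, hsum (fun k => (g : ℕ → 𝕜) k • S.unit k)]
        exact h1
      have h3 := hK N _ _ h2
      have h4 : ∑ r : Fin N, ∑ i, (g : ℕ → 𝕜) (e i) • S.unit (e (i + r)) = σ g • w := by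
        rw [Finset.sum_comm, hσ, ← hsum (fun k => (g : ℕ → 𝕜) k), Finset.sum_smul]
        refine Finset.sum_congr rfl fun i _ => ?_
        rw [← Finset.smul_sum]
        congr 1
        exact (Equiv.sum_comp (Equiv.addLeft i) (fun r => S.unit (e r))).trans (hsum S.unit)
      rw [h4] at h3
      calc _ = S.qnorm (σ g • w) := rfl
        _ ≤ _ := h3
        _ = _ := by ring) f
  have : S.qnorm (σ f • w) ≤ κ * (K * F.card * κ) * κ * S.qnorm f := hb
  rw [hq.smul, hσ] at this
  rw [mul_comm]
  refine this.trans (le_of_eq (by ring))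

end SequenceSpace

/-! ### Bounded operators -/

section Operators

variable {𝕜 : Type*} [RCLike 𝕜] {X : Type*} [AddCommGroup X] [Module 𝕜 X] {q : X → ℝ}
  {Y : Type*} [AddCommGroup Y] [Module 𝕜 Y] {r : Y → ℝ}
  {Z : Type*} [AddCommGroup Z] [Module 𝕜 Z] {p : Z → ℝ}

namespace IsBoundedOperator

theorem exists_nonneg (hq : ∀ f, 0 ≤ q f) {T : X →ₗ[𝕜] Y} (hT : IsBoundedOperator q r T) :
    ∃ C : ℝ, 0 ≤ C ∧ ∀ f, r (T f) ≤ C * q f := by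
  obtain ⟨C, hC⟩ := hT
  exact ⟨|C|, abs_nonneg C, fun f =>
    (hC f).trans (mul_le_mul_of_nonneg_right (le_abs_self C) (hq f))⟩

theorem comp (hr : ∀ g, 0 ≤ r g) {T : Y →ₗ[𝕜] Z} {R : X →ₗ[𝕜] Y}
    (hT : IsBoundedOperator r p T) (hR : IsBoundedOperator q r R) :
    IsBoundedOperator q p (T ∘ₗ R) := by
  obtain ⟨C, hC0, hC⟩ := hT.exists_nonneg hr
  obtain ⟨D, hD⟩ := hR
  refine ⟨C * D, fun f => (hC (R f)).trans ?_⟩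
  rw [mul_assoc]
  exact mul_le_mul_of_nonneg_left (hD f) hC0

theorem add (hr : IsQuasiNorm 𝕜 r) {T R : X →ₗ[𝕜] Y}
    (hT : IsBoundedOperator q r T) (hR : IsBoundedOperator q r R) :
    IsBoundedOperator q r (T + R) := by
  obtain ⟨κ, hκ1, hκ⟩ := hr.add_le
  obtain ⟨C, hC⟩ := hT
  obtain ⟨D, hD⟩ := hR
  refine ⟨κ * (C + D), fun f => (hκ _ _).trans ?_⟩
  rw [mul_assoc, add_mul]
  exact mul_le_mul_of_nonneg_left (add_le_add (hC f) (hD f)) (by linarith)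

theorem neg (hr : IsQuasiNorm 𝕜 r) {T : X →ₗ[𝕜] Y} (hT : IsBoundedOperator q r T) :
    IsBoundedOperator q r (-T) := by
  obtain ⟨C, hC⟩ := hT
  exact ⟨C, fun f => by rw [LinearMap.neg_apply, hr.map_neg]; exact hC f⟩

theorem id : IsBoundedOperator q q (LinearMap.id : X →ₗ[𝕜] X) := ⟨1, fun f => by simp⟩

end IsBoundedOperator

/-- A complemented space is a retract: the embedding has a bounded left inverse. -/
theorem IsComplementedIn.exists_retraction (hq : IsQuasiNorm 𝕜 q) (hr : IsQuasiNorm 𝕜 r)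
    (h : IsComplementedIn 𝕜 r q) :
    ∃ (J : Y →ₗ[𝕜] X) (Q : X →ₗ[𝕜] Y), IsBoundedOperator r q J ∧ IsBoundedOperator q r Q ∧
      ∀ g, Q (J g) = g := by
  obtain ⟨J, P, hJ, ⟨c, hc, hcJ⟩, ⟨C, hC⟩, hPP, hrange⟩ := h
  have hinj : Function.Injective J := (injective_iff_map_eq_zero J).2 fun g hg => by
    have := hcJ g
    rw [hg, hq.map_zero] at this
    exact (hr.eq_zero_iff g).1 (le_antisymm (nonpos_of_mul_nonpos_right this hc) (hr.nonneg g))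
  let Q : X →ₗ[𝕜] Y := (LinearEquiv.ofInjective J hinj).symm.toLinearMap ∘ₗ
    P.codRestrict (LinearMap.range J) fun f => hrange ▸ LinearMap.mem_range_self P f
  have hJQ : ∀ f, J (Q f) = P f := fun f =>
    congrArg Subtype.val ((LinearEquiv.ofInjective J hinj).apply_symm_apply ⟨P f, _⟩)
  refine ⟨J, Q, hJ, ⟨c⁻¹ * C, fun f => ?_⟩, fun g => hinj ?_⟩
  · rw [mul_assoc, ← div_eq_inv_mul, le_div_iff₀ hc, mul_comm]
    exact (hcJ _).trans (hJQ f ▸ hC f)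
  · rw [hJQ]
    obtain ⟨f, hf⟩ : J g ∈ LinearMap.range P := hrange ▸ LinearMap.mem_range_self J g
    rw [← hf]
    exact LinearMap.congr_fun hPP f

end Operators

/-! ### Biorthogonal systems with arbitrary index sets -/

section Systems

variable {𝕜 : Type*} [RCLike 𝕜] {X : Type*} [AddCommGroup X] [Module 𝕜 X]

/-- A biorthogonal system in `(X, q)`, indexed by an arbitrary type, whose vectors have dense span
and which is `M`-bounded with constant `C`. -/
structure IsFundamentalSystem {ι : Type*} (q : X → ℝ) (C : ℝ) (vec : ι → X)
    (dual : ι → X →ₗ[𝕜] 𝕜) : Prop where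
  dense_span : IsDenseSubspace q (Submodule.span 𝕜 (Set.range vec))
  dual_self : ∀ i, dual i (vec i) = 1
  dual_of_ne : ∀ i j, i ≠ j → dual i (vec j) = 0
  bound : ∀ i f, q (vec i) * ‖dual i f‖ ≤ C * q f

namespace IsFundamentalSystem

variable {q : X → ℝ} {C : ℝ} {ι : Type*} {vec : ι → X} {dual : ι → X →ₗ[𝕜] 𝕜}

theorem vec_ne_zero (h : IsFundamentalSystem q C vec dual) (i : ι) : vec i ≠ 0 := fun h0 => by
  have := h.dual_self i
  simp [h0] at this

theorem norm_dual_le (hq : IsQuasiNorm 𝕜 q) (h : IsFundamentalSystem q C vec dual) (i : ι)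
    (f : X) : ‖dual i f‖ ≤ C / q (vec i) * q f := by
  have hpos := hq.pos (h.vec_ne_zero i)
  rw [div_mul_eq_mul_div, le_div_iff₀ hpos, mul_comm]
  exact h.bound i f

theorem reindex (h : IsFundamentalSystem q C vec dual) {ι' : Type*} (e : ι' ≃ ι) :
    IsFundamentalSystem q C (vec ∘ e) (fun i => dual (e i)) where
  dense_span := by rw [e.surjective.range_comp]; exact h.dense_span
  dual_self i := h.dual_self _
  dual_of_ne i j hij := h.dual_of_ne _ _ (e.injective.ne hij)
  bound i := h.bound _

/-- The basis obtained by enumerating a fundamental system. -/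
def toSpaceBasis (hq : IsQuasiNorm 𝕜 q) (h : IsFundamentalSystem q C vec dual) (e : ℕ ≃ ι) :
    SpaceBasis 𝕜 q where
  vec n := vec (e n)
  dual n := dual (e n)
  dense_span := (h.reindex e).dense_span
  dual_bounded n := ⟨_, h.norm_dual_le hq (e n)⟩
  biorthogonal n k := by
    split_ifs with hk
    · rw [hk, h.dual_self]
    · exact h.dual_of_ne _ _ (e.injective.ne (Ne.symm hk))

end IsFundamentalSystem

/-- A space with an `M`-bounded basis and a complemented locally convex symmetric sequence space
`S` absorbs one more copy of `S`, as `S` is the sum of its subspaces of sequences supported by the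
even and by the odd numbers. This yields a fundamental system `u` whose part `u (inr ·)` is
seminormalized, with uniformly bounded averaging projections. -/
theorem exists_system_of_complemented {q : X → ℝ} (hq : IsQuasiNorm 𝕜 q)
    (B₀ : SpaceBasis 𝕜 q) (hB₀ : B₀.IsMBounded)
    (S : SequenceSpace 𝕜) (hS : S.IsSymmetric) (hSconv : IsLocallyConvexQuasiNorm S.qnorm)
    (hcompl : IsComplementedIn 𝕜 S.qnorm q) :
    ∃ (u : ℕ ⊕ ℕ → X) (u' : ℕ ⊕ ℕ → X →ₗ[𝕜] 𝕜) (c C : ℝ), 0 < c ∧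
      IsFundamentalSystem q C u u' ∧
      (∀ k, c ≤ q (u (Sum.inr k)) ∧ q (u (Sum.inr k)) ≤ C) ∧
      (∀ (F : Finset ℕ) (f : X), q (∑ k ∈ F, u (Sum.inr k)) * ‖∑ k ∈ F, u' (Sum.inr k) f‖ ≤
        C * F.card * q f) ∧
      (B₀.IsTotal → ∀ f, (∀ i, u' i f = 0) → f = 0) := by
  have hr := S.isQuasiBanach.toIsQuasiNorm
  obtain ⟨κ, hκ1, hκ⟩ := hq.add_le
  obtain ⟨J, Q, hJ, hQ, hQJ⟩ := hcompl.exists_retraction hq hr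
  have hev : Function.Injective fun n : ℕ => 2 * n := fun a b h => by simpa using h
  have hod : Function.Injective fun n : ℕ => 2 * n + 1 := fun a b h => by simpa using h
  have hne : ∀ k : ℕ, ¬∃ a, (fun n : ℕ => 2 * n) a = 2 * k + 1 := by
    rintro k ⟨a, ha⟩; simp at ha; omega
  have hno : ∀ k : ℕ, ¬∃ a, (fun n : ℕ => 2 * n + 1) a = 2 * k := by
    rintro k ⟨a, ha⟩; simp at ha; omega
  obtain ⟨D₀, hD₀b, hD₀⟩ := hS.exists_extend hev
  obtain ⟨D₁, hD₁b, hD₁⟩ := hS.exists_extend hod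
  obtain ⟨R₀, hR₀b, hR₀⟩ := hS.exists_comp hev
  obtain ⟨R₁, hR₁b, hR₁⟩ := hS.exists_comp hod
  have hRD₀₀ : ∀ s, R₀ (D₀ s) = s := fun s => Subtype.ext <| funext fun n => by
    rw [hR₀, hD₀, Function.comp, hev.extend_apply]
  have hRD₁₁ : ∀ s, R₁ (D₁ s) = s := fun s => Subtype.ext <| funext fun n => by
    rw [hR₁, hD₁, Function.comp, hod.extend_apply]
  have hRD₀₁ : ∀ s, R₀ (D₁ s) = 0 := fun s => Subtype.ext <| funext fun n => by
    rw [hR₀, hD₁, Function.comp, Function.extend_apply' _ _ _ (hno n)]; rfl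
  have hRD₁₀ : ∀ s, R₁ (D₀ s) = 0 := fun s => Subtype.ext <| funext fun n => by
    rw [hR₁, hD₀, Function.comp, Function.extend_apply' _ _ _ (hne n)]; rfl
  have hDR : ∀ s, D₀ (R₀ s) + D₁ (R₁ s) = s := fun s => Subtype.ext <| funext fun n => by
    rw [Submodule.coe_add, Pi.add_apply, hD₀, hD₁, hR₀, hR₁]
    rcases Nat.even_or_odd' n with ⟨k, rfl | rfl⟩
    · rw [Function.extend_apply' _ _ _ (hno k)]
      simpa using hev.extend_apply ((s : ℕ → 𝕜) ∘ fun n => 2 * n) 0 k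
    · rw [Function.extend_apply' _ _ _ (hne k)]
      simpa using hod.extend_apply ((s : ℕ → 𝕜) ∘ fun n => 2 * n + 1) 0 k
  have hDunit : ∀ k, D₁ (S.unit k) = S.unit (2 * k + 1) := fun k =>
    Subtype.ext <| funext fun n => by
      rw [hD₁]
      by_cases hn : ∃ a, (fun n : ℕ => 2 * n + 1) a = n
      · obtain ⟨a, rfl⟩ := hn
        rw [hod.extend_apply]
        simp [S.unit_apply]
      · have : n ≠ 2 * k + 1 := fun h => hn ⟨k, h.symm⟩
        rw [Function.extend_apply' _ _ _ hn]
        simp [S.unit_apply, this]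
  -- `Φ` moves the copy of `S` to its even half; `Ψ` is a left inverse of `Φ`.
  let Φ : X →ₗ[𝕜] X := LinearMap.id + -(J ∘ₗ Q) + J ∘ₗ D₀ ∘ₗ Q
  let Ψ : X →ₗ[𝕜] X := LinearMap.id + -(J ∘ₗ Q) + J ∘ₗ R₀ ∘ₗ Q
  have hΦ : ∀ f, Φ f = f + -J (Q f) + J (D₀ (Q f)) := fun f => rfl
  have hΨ : ∀ f, Ψ f = f + -J (Q f) + J (R₀ (Q f)) := fun f => rfl
  have hΦb : IsBoundedOperator q q Φ :=
    ((IsBoundedOperator.id.add hq ((hJ.comp hr.nonneg hQ).neg hq)).add hq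
      (hJ.comp hr.nonneg (hD₀b.comp hr.nonneg hQ)))
  have hΨb : IsBoundedOperator q q Ψ :=
    ((IsBoundedOperator.id.add hq ((hJ.comp hr.nonneg hQ).neg hq)).add hq
      (hJ.comp hr.nonneg (hR₀b.comp hr.nonneg hQ)))
  have hQΦ : ∀ f, Q (Φ f) = D₀ (Q f) := fun f => by simp [hΦ, hQJ]
  have hQΨ : ∀ f, Q (Ψ f) = R₀ (Q f) := fun f => by simp [hΨ, hQJ]
  have hΨΦ : ∀ f, Ψ (Φ f) = f := fun f => by
    rw [hΨ, hQΦ, hΦ, hRD₀₀]; abel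
  have hΨJ : ∀ s, Ψ (J s) = J (R₀ s) := fun s => by rw [hΨ, hQJ]; abel
  have hdecomp : ∀ f, Φ (Ψ f) + J (D₁ (R₁ (Q f))) = f := fun f => by
    have h1 := congrArg J (hDR (Q f))
    rw [map_add] at h1
    rw [hΦ, hQΨ, hΨ, add_assoc, h1]; abel
  let coord : ℕ → S.carrier →ₗ[𝕜] 𝕜 := fun n => LinearMap.proj n ∘ₗ S.carrier.subtype
  let u : ℕ ⊕ ℕ → X := Sum.elim (fun n => Φ (B₀.vec n)) fun n => J (D₁ (S.unit n))
  let u' : ℕ ⊕ ℕ → X →ₗ[𝕜] 𝕜 :=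
    Sum.elim (fun n => B₀.dual n ∘ₗ Ψ) fun n => coord n ∘ₗ R₁ ∘ₗ Q
  obtain ⟨C₀, hC₀, hC₀b⟩ := hB₀.exists_bound hq
  obtain ⟨CΦ, hCΦ, hCΦb⟩ := hΦb.exists_nonneg hq.nonneg
  obtain ⟨CΨ, hCΨ, hCΨb⟩ := hΨb.exists_nonneg hq.nonneg
  obtain ⟨CJ, hCJ, hCJb⟩ := (hJ.comp hr.nonneg hD₁b).exists_nonneg hr.nonneg
  obtain ⟨CR, hCR, hCRb⟩ := (hR₁b.comp hr.nonneg hQ).exists_nonneg hq.nonneg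
  obtain ⟨Ca, hCa, hCab⟩ := hS.exists_averaging_bound hSconv
  have hstar : ∀ (F : Finset ℕ) (f : X), q (∑ k ∈ F, u (Sum.inr k)) *
      ‖∑ k ∈ F, u' (Sum.inr k) f‖ ≤ CJ * Ca * CR * F.card * q f := fun F f => by
    have e : ∑ k ∈ F, u (Sum.inr k) = J (D₁ (∑ k ∈ F, S.unit k)) := by simp [u]
    rw [e]
    calc q (J (D₁ (∑ k ∈ F, S.unit k))) * ‖∑ k ∈ F, u' (Sum.inr k) f‖
        ≤ CJ * S.qnorm (∑ k ∈ F, S.unit k) * ‖∑ k ∈ F, (R₁ (Q f) : ℕ → 𝕜) k‖ :=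
          mul_le_mul_of_nonneg_right (hCJb _) (norm_nonneg _)
      _ ≤ CJ * (Ca * F.card * S.qnorm (R₁ (Q f))) := by
          rw [mul_assoc]; exact mul_le_mul_of_nonneg_left (hCab F _) hCJ
      _ ≤ CJ * (Ca * F.card * (CR * q f)) := by
          gcongr; exact hCRb f
      _ = _ := by ring
  obtain ⟨CQ, hCQ, hCQb⟩ := hQ.exists_nonneg hq.nonneg
  have hunit : 0 < S.qnorm (S.unit 0) := hr.pos (S.unit_ne_zero 0)
  let C := max (max (CΦ * C₀ * CΨ) (CJ * Ca * CR)) (CJ * S.qnorm (S.unit 0))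
  have hC1 : CΦ * C₀ * CΨ ≤ C := (le_max_left _ _).trans (le_max_left _ _)
  have hC2 : CJ * Ca * CR ≤ C := (le_max_right _ _).trans (le_max_left _ _)
  refine ⟨u, u', S.qnorm (S.unit 0) / (CQ + 1), C, by positivity, ⟨fun f ε hε => ?_, ?_, ?_, ?_⟩,
    fun k => ⟨?_, ?_⟩, fun F f => ?_, fun htot f hf => ?_⟩
  · have hδ : 0 < ε / (κ * (CΦ + CJ) + 1) := by positivity
    obtain ⟨g, hg, hgf⟩ := B₀.dense_span (Ψ f) _ hδ
    obtain ⟨s, hs, hsf⟩ := S.dense_span (R₁ (Q f)) _ hδ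
    refine ⟨Φ g + J (D₁ s), Submodule.add_mem _ ?_ ?_, ?_⟩
    · have : (Submodule.span 𝕜 (Set.range B₀.vec)).map Φ ≤ Submodule.span 𝕜 (Set.range u) := by
        rw [Submodule.map_span_le]
        rintro _ ⟨n, rfl⟩
        exact Submodule.subset_span ⟨Sum.inl n, rfl⟩
      exact this (Submodule.mem_map_of_mem hg)
    · have : (Submodule.span 𝕜 (Set.range S.unit)).map (J ∘ₗ D₁) ≤
          Submodule.span 𝕜 (Set.range u) := by
        rw [Submodule.map_span_le]
        rintro _ ⟨n, rfl⟩
        exact Submodule.subset_span ⟨Sum.inr n, rfl⟩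
      exact this (Submodule.mem_map_of_mem (f := J ∘ₗ D₁) hs)
    · have e : f - (Φ g + J (D₁ s)) = Φ (Ψ f - g) + (J ∘ₗ D₁) (R₁ (Q f) - s) := by
        conv_lhs => rw [← hdecomp f]
        simp only [map_sub, LinearMap.comp_apply]; abel
      rw [e]
      calc _ ≤ κ * (CΦ * q (Ψ f - g) + CJ * S.qnorm (R₁ (Q f) - s)) :=
            (hκ _ _).trans (mul_le_mul_of_nonneg_left (add_le_add (hCΦb _) (hCJb _))
              (by linarith))
        _ ≤ κ * (CΦ * (ε / (κ * (CΦ + CJ) + 1)) + CJ * (ε / (κ * (CΦ + CJ) + 1))) := by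
            gcongr
        _ = ε * ((κ * (CΦ + CJ)) / (κ * (CΦ + CJ) + 1)) := by ring
        _ < ε := by
            refine mul_lt_of_lt_one_right hε ((div_lt_one (by positivity)).2 (by linarith))
  · rintro (n | n)
    · simp [u, u', hΨΦ, B₀.biorthogonal]
    · simp [u, u', hQJ, hRD₁₁, coord, S.unit_apply]
  · rintro (n | n) (k | k) hnk
    · have : k ≠ n := fun h => hnk (by rw [h])
      simp [u, u', hΨΦ, B₀.biorthogonal, this]
    · simp [u, u', hΨJ, hRD₀₁]
    · simp [u, u', hQΦ, hRD₁₀]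
    · have : n ≠ k := fun h => hnk (by rw [h])
      simp [u, u', hQJ, hRD₁₁, coord, S.unit_apply, this]
  · rintro (n | n) f
    · calc q (u (Sum.inl n)) * ‖u' (Sum.inl n) f‖
          ≤ CΦ * q (B₀.vec n) * ‖B₀.dual n (Ψ f)‖ :=
            mul_le_mul_of_nonneg_right (hCΦb _) (norm_nonneg _)
        _ ≤ CΦ * (C₀ * q (Ψ f)) := by
            rw [mul_assoc]; exact mul_le_mul_of_nonneg_left (hC₀b _ _) hCΦ
        _ ≤ CΦ * (C₀ * (CΨ * q f)) := by gcongr; exact hCΨb f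
        _ = CΦ * C₀ * CΨ * q f := by ring
        _ ≤ C * q f := mul_le_mul_of_nonneg_right hC1 (hq.nonneg f)
    · have := hstar {n} f
      simp only [Finset.sum_singleton, Finset.card_singleton, Nat.cast_one, mul_one] at this
      exact this.trans (mul_le_mul_of_nonneg_right hC2 (hq.nonneg f))
  · have h1 := hCQb (J (D₁ (S.unit k)))
    rw [hQJ, hDunit, hS.qnorm_unit _ 0] at h1
    rw [div_le_iff₀ (by positivity)]
    show _ ≤ q (J (D₁ (S.unit k))) * _
    rw [hDunit]
    nlinarith [hq.nonneg (J (S.unit (2 * k + 1)))]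
  · have h1 := hCJb (S.unit k)
    rw [hS.qnorm_unit k 0] at h1
    exact h1.trans (le_max_right _ _)
  · refine (hstar F f).trans ?_
    have := hq.nonneg f
    gcongr
  · have h1 : R₁ (Q f) = 0 := Subtype.ext <| funext fun n => hf (Sum.inr n)
    have h2 : Ψ f = 0 := htot <| funext fun n => by
      exact (hf (Sum.inl n)).trans (map_zero _).symm
    rw [← hdecomp f, h1, h2]; simp

end Systems

/-! ### The change of basis in a finite block -/

section Block

variable {𝕜 : Type*} [RCLike 𝕜] {X : Type*} [AddCommGroup X] [Module 𝕜 X]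
  {α : Type*} [Fintype α]

/-- The new vectors of a block. The old vectors `a` consist of two families `e_j` and `g_j` indexed
by `α`, at `inl (some j)` and `inr (some j)`, and of two single vectors `f` and `h`, at `inl none`
and `inr none`. The vectors `∑ e_j` and `∑ g_j` take the places of `f` and `h`. -/
noncomputable def blockVec (ε : α → 𝕜) (a : Option α ⊕ Option α → X) :
    Option α ⊕ Option α → X
  | Sum.inl (some j) => a (Sum.inl (some j)) -
      (Fintype.card α : 𝕜)⁻¹ • ∑ k, a (Sum.inl (some k)) +
      ((Fintype.card α : 𝕜)⁻¹ • a (Sum.inl none) + ε j • a (Sum.inr none))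
  | Sum.inl none => ∑ k, a (Sum.inl (some k))
  | Sum.inr (some i) => a (Sum.inr (some i)) -
      (Fintype.card α : 𝕜)⁻¹ • ∑ k, a (Sum.inr (some k)) + a (Sum.inr none)
  | Sum.inr none => ∑ k, a (Sum.inr (some k))

/-- The functionals biorthogonal to `blockVec ε a`, in terms of functionals `a'` biorthogonal
to `a`. -/
noncomputable def blockDual (ε : α → 𝕜) (a' : Option α ⊕ Option α → X →ₗ[𝕜] 𝕜) :
    Option α ⊕ Option α → X →ₗ[𝕜] 𝕜
  | Sum.inl (some j) => a' (Sum.inl (some j)) -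
      (Fintype.card α : 𝕜)⁻¹ • ∑ k, a' (Sum.inl (some k)) + a' (Sum.inl none)
  | Sum.inl none => (Fintype.card α : 𝕜)⁻¹ • ∑ k, a' (Sum.inl (some k))
  | Sum.inr (some i) => a' (Sum.inr (some i)) -
      (Fintype.card α : 𝕜)⁻¹ • ∑ k, a' (Sum.inr (some k)) +
      (Fintype.card α : 𝕜)⁻¹ • (a' (Sum.inr none) - ∑ k, ε k • a' (Sum.inl (some k)))
  | Sum.inr none => (Fintype.card α : 𝕜)⁻¹ • ∑ k, a' (Sum.inr (some k))

variable {ε : α → 𝕜} {a : Option α ⊕ Option α → X} {a' : Option α ⊕ Option α → X →ₗ[𝕜] 𝕜}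

theorem blockDual_apply_eq_zero {f : X} (h : ∀ b, a' b f = 0) (b) : blockDual ε a' b f = 0 := by
  rcases b with (_ | j) | (_ | j) <;> simp [blockDual, h]

theorem apply_blockVec_eq_zero {φ : X →ₗ[𝕜] 𝕜} (h : ∀ b, φ (a b) = 0) (b) :
    φ (blockVec ε a b) = 0 := by
  rcases b with (_ | j) | (_ | j) <;> simp [blockVec, h]

theorem blockDual_blockVec [Nonempty α] [DecidableEq α] (hε : ∑ j, ε j = 0)
    (h : ∀ b c, a' b (a c) = if b = c then 1 else 0) (b c) :
    blockDual ε a' b (blockVec ε a c) = if b = c then 1 else 0 := by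
  have hN : (Fintype.card α : 𝕜) ≠ 0 := Nat.cast_ne_zero.2 Fintype.card_ne_zero
  rcases b with (_ | i) | (_ | i) <;> rcases c with (_ | j) | (_ | j) <;>
    simp [blockDual, blockVec, h, hN, hε, ← Finset.mul_sum]
  simp [mul_sub, Finset.sum_sub_distrib, ← Finset.sum_mul, hε]

theorem sum_blockVec [Nonempty α] (hε : ∑ j, ε j = 0) :
    ∑ j, blockVec ε a (Sum.inl (some j)) = a (Sum.inl none) := by
  have hN : (Fintype.card α : 𝕜) ≠ 0 := Nat.cast_ne_zero.2 Fintype.card_ne_zero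
  simp only [blockVec, Finset.sum_add_distrib, Finset.sum_sub_distrib, Finset.sum_const,
    Finset.card_univ, ← Finset.sum_smul, hε, zero_smul, add_zero]
  simp only [← Nat.cast_smul_eq_nsmul 𝕜, smul_smul, mul_inv_cancel₀ hN, one_smul, sub_self,
    zero_add]

theorem mem_span_blockVec [Nonempty α] (hε : ∑ j, ε j = 0) (b) :
    a b ∈ Submodule.span 𝕜 (Set.range (blockVec ε a)) := by
  have hN : (Fintype.card α : 𝕜) ≠ 0 := Nat.cast_ne_zero.2 Fintype.card_ne_zero
  set V := Submodule.span 𝕜 (Set.range (blockVec ε a))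
  have hV : ∀ c, blockVec ε a c ∈ V := fun c => Submodule.subset_span ⟨c, rfl⟩
  have hf : a (Sum.inl none) ∈ V := sum_blockVec (a := a) hε ▸ V.sum_mem fun j _ => hV _
  have hE : ∑ k, a (Sum.inl (some k)) ∈ V := hV (Sum.inl none)
  have hG : ∑ k, a (Sum.inr (some k)) ∈ V := hV (Sum.inr none)
  have hh : a (Sum.inr none) ∈ V := by
    have e : (Fintype.card α : 𝕜)⁻¹ • ∑ i, blockVec ε a (Sum.inr (some i)) = a (Sum.inr none) := by
      simp only [blockVec, Finset.sum_add_distrib, Finset.sum_sub_distrib, Finset.sum_const,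
        Finset.card_univ]
      simp only [← Nat.cast_smul_eq_nsmul 𝕜, smul_smul, mul_inv_cancel₀ hN, inv_mul_cancel₀ hN,
        one_smul, sub_self, zero_add]
    exact e ▸ V.smul_mem _ (V.sum_mem fun j _ => hV _)
  rcases b with (_ | j) | (_ | j)
  · exact hf
  · have := V.add_mem (V.sub_mem (hV (Sum.inl (some j)))
      (V.add_mem (V.smul_mem (Fintype.card α : 𝕜)⁻¹ hf) (V.smul_mem (ε j) hh)))
      (V.smul_mem (Fintype.card α : 𝕜)⁻¹ hE)
    simpa only [blockVec, add_sub_cancel_right, sub_add_cancel] using this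
  · exact hh
  · have := V.add_mem (V.sub_mem (hV (Sum.inr (some j))) hh)
      (V.smul_mem (Fintype.card α : 𝕜)⁻¹ hG)
    simpa only [blockVec, add_sub_cancel_right, sub_add_cancel] using this

theorem apply_eq_zero_of_blockDual [Nonempty α] {f : X} (h : ∀ b, blockDual ε a' b f = 0) (b) :
    a' b f = 0 := by
  have hN : (Fintype.card α : 𝕜) ≠ 0 := Nat.cast_ne_zero.2 Fintype.card_ne_zero
  have hE : ∑ k, a' (Sum.inl (some k)) f = 0 := by
    simpa [blockDual, hN] using h (Sum.inl none)
  have hG : ∑ k, a' (Sum.inr (some k)) f = 0 := by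
    simpa [blockDual, hN] using h (Sum.inr none)
  have hej : ∀ j, a' (Sum.inl (some j)) f + a' (Sum.inl none) f = 0 := fun j => by
    simpa [blockDual, hE] using h (Sum.inl (some j))
  have hf : a' (Sum.inl none) f = 0 := by
    have := Finset.sum_congr rfl fun j (_ : j ∈ Finset.univ) => hej j
    simpa [Finset.sum_add_distrib, hE, hN] using this
  have he : ∀ j, a' (Sum.inl (some j)) f = 0 := fun j => by simpa [hf] using hej j
  have hgi : ∀ i, a' (Sum.inr (some i)) f + (Fintype.card α : 𝕜)⁻¹ * a' (Sum.inr none) f = 0 :=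
    fun i => by simpa [blockDual, hG, he] using h (Sum.inr (some i))
  have hh : a' (Sum.inr none) f = 0 := by
    have := Finset.sum_congr rfl fun j (_ : j ∈ Finset.univ) => hgi j
    simpa [Finset.sum_add_distrib, hG, hN] using this
  rcases b with (_ | j) | (_ | j)
  · exact hf
  · exact he j
  · exact hh
  · simpa [hh] using hgi j

/-- The coefficient of a partial sum of the vectors `blockVec ε a (inl (some j))` at the old vector
`a (inr none)`: although the total sum is `a (inl none)`, partial sums need not be small. -/
theorem apply_sum_blockVec [DecidableEq α] (h : ∀ b c, a' b (a c) = if b = c then 1 else 0)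
    (T : Finset α) :
    a' (Sum.inr none) (∑ j ∈ T, blockVec ε a (Sum.inl (some j))) = ∑ j ∈ T, ε j := by
  simp [blockVec, h]

/-- The new block is `M`-bounded, with a constant that does not depend on its size, if the
averaging projections of both families of the old block are bounded. -/
theorem qnorm_blockVec_mul_le [Nonempty α] {q : X → ℝ} (hq : IsQuasiNorm 𝕜 q) {κ C : ℝ}
    (hκ1 : 1 ≤ κ) (hκ : ∀ f g, q (f + g) ≤ κ * (q f + q g)) (hC : 1 ≤ C)
    (hε : ∀ j, ‖ε j‖ ≤ 1) (ha : ∀ b, q (a b) ≤ C) (ha' : ∀ b f, ‖a' b f‖ ≤ C * q f)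
    (haa' : ∀ b, a' b (a b) = 1) (hne : ∀ b c, b ≠ c → a' b (a c) = 0)
    (hE : ∀ f, q (∑ k, a (Sum.inl (some k))) * ‖∑ k, a' (Sum.inl (some k)) f‖ ≤
      C * Fintype.card α * q f)
    (hG : ∀ f, q (∑ k, a (Sum.inr (some k))) * ‖∑ k, a' (Sum.inr (some k)) f‖ ≤
      C * Fintype.card α * q f) (b) (f : X) :
    q (blockVec ε a b) * ‖blockDual ε a' b f‖ ≤ 16 * κ ^ 2 * C ^ 3 * q f := by
  classical
  have hN0 : (0 : ℝ) < Fintype.card α := Nat.cast_pos.2 Fintype.card_pos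
  have hN1 : (1 : ℝ) ≤ Fintype.card α := Nat.one_le_cast.2 Fintype.card_pos
  have hNn : ‖(Fintype.card α : 𝕜)⁻¹‖ = (Fintype.card α : ℝ)⁻¹ := by simp
  have hNi : (Fintype.card α : ℝ)⁻¹ ≤ 1 := inv_le_one_of_one_le₀ hN1
  have hf0 := hq.nonneg f
  obtain ⟨j₀⟩ := ‹Nonempty α›
  have hCC : C ≤ C ^ 2 := by nlinarith
  -- The averaging estimates, applied to a single vector, bound the means themselves.
  have mean : ∀ g : α → Option α ⊕ Option α, Function.Injective g →
      (∀ f, q (∑ k, a (g k)) * ‖∑ k, a' (g k) f‖ ≤ C * Fintype.card α * q f) →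
      q ((Fintype.card α : 𝕜)⁻¹ • ∑ k, a (g k)) ≤ C ^ 2 := fun g hg h => by
    have h1 := h (a (g j₀))
    have h2 : ∑ k, a' (g k) (a (g j₀)) = 1 := by
      rw [Finset.sum_eq_single j₀ (fun k _ hk => hne _ _ (hg.ne hk)) (by simp), haa']
    rw [h2, norm_one, mul_one] at h1
    rw [hq.smul, hNn, inv_mul_le_iff₀ hN0]
    calc _ ≤ _ := h1
      _ ≤ C * Fintype.card α * C := by gcongr; exact ha _
      _ = _ := by ring
  have hEm := mean (fun k => Sum.inl (some k)) (fun i j h => by simpa using h) hE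
  have hGm := mean (fun k => Sum.inr (some k)) (fun i j h => by simpa using h) hG
  have add2 : ∀ {x y : X} {t : ℝ}, q x ≤ t → q y ≤ t → q (x + y) ≤ 2 * κ * t :=
    fun {x y t} hx hy => (hκ x y).trans (by nlinarith)
  have sub2 : ∀ {x y : X} {t : ℝ}, q x ≤ t → q y ≤ t → q (x - y) ≤ 2 * κ * t :=
    fun {x y t} hx hy => by
      rw [sub_eq_add_neg]
      exact add2 hx (by rwa [hq.map_neg])
  have smul1 : ∀ {x : X} {t : ℝ} {s : 𝕜}, ‖s‖ ≤ 1 → q x ≤ t → q (s • x) ≤ t :=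
    fun {x t s} hs hx => by
      rw [hq.smul]
      exact (mul_le_of_le_one_left (hq.nonneg _) hs).trans hx
  have hmeanE : ‖(Fintype.card α : 𝕜)⁻¹ * ∑ k, a' (Sum.inl (some k)) f‖ ≤ C * q f := by
    rw [norm_mul, hNn, inv_mul_le_iff₀ hN0]
    refine (norm_sum_le_of_le _ fun k _ => ha' _ f).trans ?_
    simp
  have hmeanG : ‖(Fintype.card α : 𝕜)⁻¹ * ∑ k, a' (Sum.inr (some k)) f‖ ≤ C * q f := by
    rw [norm_mul, hNn, inv_mul_le_iff₀ hN0]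
    refine (norm_sum_le_of_le _ fun k _ => ha' _ f).trans ?_
    simp
  have hmeanε : ‖(Fintype.card α : 𝕜)⁻¹ * ∑ k, ε k * a' (Sum.inl (some k)) f‖ ≤ C * q f := by
    rw [norm_mul, hNn, inv_mul_le_iff₀ hN0]
    refine (norm_sum_le_of_le _ (f := fun k => ε k * a' (Sum.inl (some k)) f)
      (n := fun _ => C * q f) fun k _ => ?_).trans ?_
    · rw [norm_mul]
      exact (mul_le_of_le_one_left (norm_nonneg _) (hε k)).trans (ha' _ f)
    · simp
  have hmul : ∀ {x y : ℝ}, x ≤ 2 * κ * (2 * κ * C ^ 2) → 0 ≤ y → y ≤ 4 * (C * q f) →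
      x * y ≤ 16 * κ ^ 2 * C ^ 3 * q f := fun {x y} hx hy0 hy => by
    calc x * y ≤ 2 * κ * (2 * κ * C ^ 2) * (4 * (C * q f)) := by gcongr
      _ = _ := by ring
  have hbig : C * q f ≤ 16 * κ ^ 2 * C ^ 3 * q f := by
    refine mul_le_mul_of_nonneg_right ?_ hf0
    have h1 : 1 ≤ κ ^ 2 := one_le_pow₀ hκ1
    have h2 : C ≤ C ^ 3 := le_self_pow₀ hC (by norm_num)
    nlinarith
  have hCq : 0 ≤ C * q f := by positivity
  rcases b with (_ | j) | (_ | j)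
  · simp only [blockVec, blockDual, LinearMap.smul_apply, LinearMap.sum_apply, smul_eq_mul]
    rw [norm_mul, hNn, mul_left_comm, inv_mul_le_iff₀ hN0]
    refine (hE f).trans ?_
    nlinarith
  · refine hmul ?_ (norm_nonneg _) ?_
    · refine add2 (sub2 ((ha _).trans hCC) hEm) (add2 ?_ ?_)
      · exact smul1 (hNn.trans_le hNi) ((ha _).trans hCC)
      · exact smul1 (hε j) ((ha _).trans hCC)
    · simp only [blockDual, LinearMap.add_apply, LinearMap.sub_apply, LinearMap.smul_apply,
        LinearMap.sum_apply, smul_eq_mul]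
      refine (norm_add_le_of_le (norm_sub_le_of_le (ha' _ f) hmeanE) (ha' _ f)).trans ?_
      linarith
  · simp only [blockVec, blockDual, LinearMap.smul_apply, LinearMap.sum_apply, smul_eq_mul]
    rw [norm_mul, hNn, mul_left_comm, inv_mul_le_iff₀ hN0]
    refine (hG f).trans ?_
    nlinarith
  · refine hmul ?_ (norm_nonneg _) ?_
    · refine add2 (sub2 ((ha _).trans hCC) hGm) (((ha _).trans hCC).trans ?_)
      nlinarith [sq_nonneg C]
    · simp only [blockDual, LinearMap.add_apply, LinearMap.sub_apply, LinearMap.smul_apply,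
        LinearMap.sum_apply, smul_eq_mul, mul_sub]
      have h1 : ‖(Fintype.card α : 𝕜)⁻¹ * a' (Sum.inr none) f‖ ≤ C * q f := by
        rw [norm_mul, hNn]
        exact (mul_le_of_le_one_left (norm_nonneg _) hNi).trans (ha' _ f)
      refine (norm_add_le_of_le (norm_sub_le_of_le (ha' _ f) hmeanG)
        (norm_sub_le_of_le h1 hmeanε)).trans ?_
      linarith

end Block

/-! ### Enumeration of the blocks -/

/-- If the `k`-th block has fewer than `2 ^ (k + 3)` elements, then the union of the blocks and of
a further copy of `ℕ` can be enumerated in such a way that the `k`-th block lies among the first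
`2 ^ (k + 4)` places. -/
theorem exists_equiv_sigma_sum_nat {β : ℕ → Type*} [∀ k, Fintype (β k)]
    (hβ : ∀ k, Fintype.card (β k) < 2 ^ (k + 3)) :
    ∃ e : ℕ ≃ (Σ k, β k) ⊕ ℕ, ∀ k b, e.symm (Sum.inl ⟨k, b⟩) < 2 ^ (k + 4) := by
  classical
  let p : (Σ k, β k) → ℕ := fun x => 2 ^ (x.1 + 3) + (Fintype.equivFin (β x.1) x.2 : ℕ)
  have hlt : ∀ x, p x + 1 < 2 ^ (x.1 + 4) := fun x => by
    have h1 := (Fintype.equivFin (β x.1) x.2).2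
    have h2 := hβ x.1
    have h3 : 2 ^ (x.1 + 4) = 2 ^ (x.1 + 3) + 2 ^ (x.1 + 3) := by ring
    simp only [p]
    omega
  have hlog : ∀ x, Nat.log 2 (p x) = x.1 + 3 := fun x =>
    Nat.log_eq_of_pow_le_of_lt_pow (Nat.le_add_right _ _) ((Nat.lt_succ_self _).trans (hlt x))
  have hp : Function.Injective p := by
    rintro ⟨k, b⟩ ⟨l, c⟩ h
    obtain rfl : k = l := by
      have := hlog ⟨k, b⟩
      rw [h, hlog ⟨l, c⟩] at this
      simpa using this.symm
    have h1 : (Fintype.equivFin (β k) b : ℕ) = Fintype.equivFin (β k) c := by simpa [p] using h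
    rw [(Fintype.equivFin (β k)).injective (Fin.ext h1)]
  -- The last place of each dyadic interval is free.
  have hinf : (Set.range p)ᶜ.Infinite := by
    refine Set.infinite_of_injective_forall_mem (f := fun k : ℕ => 2 ^ (k + 4) - 1) ?_ ?_
    · intro k l (h : 2 ^ (k + 4) - 1 = 2 ^ (l + 4) - 1)
      have h1 := Nat.one_le_two_pow (n := k + 4)
      have h2 := Nat.one_le_two_pow (n := l + 4)
      have h3 : 2 ^ (k + 4) = 2 ^ (l + 4) := by omega
      simpa using Nat.pow_right_injective le_rfl h3
    · rintro k ⟨x, hx⟩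
      have h1 : Nat.log 2 (2 ^ (k + 4) - 1) = k + 3 := by
        refine Nat.log_eq_of_pow_le_of_lt_pow ?_ ?_
        · have : 2 ^ (k + 4) = 2 ^ (k + 3) + 2 ^ (k + 3) := by ring
          have := Nat.one_le_two_pow (n := k + 3)
          omega
        · have := Nat.one_le_two_pow (n := k + 4)
          exact Nat.sub_lt this one_pos
      have h2 := hlog x
      rw [hx, h1] at h2
      have h3 := hlt x
      rw [hx, ← Nat.add_right_cancel h2] at h3
      omega
  have : Infinite ↑(Set.range p)ᶜ := hinf.to_subtype
  let e : (Σ k, β k) ⊕ ℕ ≃ ℕ := ((Equiv.ofInjective p hp).sumCongr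
    (Nat.Subtype.orderIsoOfNat (Set.range p)ᶜ).toEquiv).trans (Equiv.Set.sumCompl (Set.range p))
  refine ⟨e.symm, fun k b => ?_⟩
  have : e (Sum.inl ⟨k, b⟩) = p ⟨k, b⟩ := by simp [e]
  rw [Equiv.symm_symm, this]
  exact (Nat.lt_succ_self _).trans (hlt _)

/-! ### The modified basis -/

section Assembly

variable {𝕜 : Type*} [RCLike 𝕜] {X : Type*} [AddCommGroup X] [Module 𝕜 X] {q : X → ℝ}

theorem SpaceBasis.le_kTilde (hq : IsQuasiNorm 𝕜 q) (B : SpaceBasis 𝕜 q) {m : ℕ}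
    {s t : Finset ℕ} (hts : t ⊆ s) (hs : ∀ n ∈ s, n < m) (h0 : ∑ n ∈ s, B.vec n ≠ 0) :
    ENNReal.ofReal (q (∑ n ∈ t, B.vec n) / q (∑ n ∈ s, B.vec n)) ≤ B.kTilde m := by
  have hpos := hq.pos h0
  obtain ⟨f, hf⟩ : ∃ f, f = ∑ n ∈ s, B.vec n := ⟨_, rfl⟩
  rw [← hf] at hpos ⊢
  let c : 𝕜 := (((q f)⁻¹ : ℝ) : 𝕜)
  have hc : ‖c‖ = (q f)⁻¹ := by
    rw [RCLike.norm_ofReal, abs_of_pos (inv_pos.2 hpos)]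
  have h1 : q (c • f) ≤ 1 := by rw [hq.smul, hc, inv_mul_cancel₀ hpos.ne']
  have h2 : c • f ∈ Submodule.span 𝕜 (B.vec '' {j | j < m}) :=
    Submodule.smul_mem _ _ (hf ▸ Submodule.sum_mem _ fun n hn =>
      Submodule.subset_span ⟨n, hs n hn, rfl⟩)
  have h3 : B.coordProj t (c • f) = c • ∑ n ∈ t, B.vec n := by
    rw [SpaceBasis.coordProj, Finset.smul_sum]
    refine Finset.sum_congr rfl fun n hn => ?_
    simp [hf, B.biorthogonal, hts hn]
  have h4 : q (∑ n ∈ t, B.vec n) / q f = q (B.coordProj t (c • f)) := by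
    rw [h3, hq.smul, hc, div_eq_inv_mul]
  rw [h4]
  exact le_iSup_of_le (c • f) (le_iSup_of_le h1 (le_iSup_of_le h2
    (le_iSup (fun A => ENNReal.ofReal (q (B.coordProj A (c • f)))) t)))

/-- The index set of the `k`-th block. -/
abbrev BlockIndex (k : ℕ) : Type :=
  Option (Fin (2 ^ k) × Bool) ⊕ Option (Fin (2 ^ k) × Bool)

/-- The balanced signs of the `k`-th block. -/
def blockSign (𝕜 : Type*) [RCLike 𝕜] (k : ℕ) : Fin (2 ^ k) × Bool → 𝕜 :=
  fun j => if j.2 then 1 else -1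

theorem sum_blockSign (k : ℕ) : ∑ j, blockSign 𝕜 k j = 0 := by
  simp [blockSign, Fintype.sum_prod_type]

theorem norm_blockSign (k : ℕ) (j) : ‖blockSign 𝕜 k j‖ ≤ 1 := by
  unfold blockSign
  split_ifs <;> simp

section Modified

variable (U : (Σ k, BlockIndex k) ⊕ ℕ → X) (U' : (Σ k, BlockIndex k) ⊕ ℕ → X →ₗ[𝕜] 𝕜)

/-- The system obtained from `U` by the change of basis `blockVec` in each block. -/
noncomputable def modifiedVec (𝕜 : Type*) [RCLike 𝕜] [Module 𝕜 X]
    (U : (Σ k, BlockIndex k) ⊕ ℕ → X) : (Σ k, BlockIndex k) ⊕ ℕ → X :=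
  Sum.elim (fun x => blockVec (blockSign 𝕜 x.1) (fun b => U (Sum.inl ⟨x.1, b⟩)) x.2)
    fun n => U (Sum.inr n)

/-- The functionals biorthogonal to `modifiedVec`. -/
noncomputable def modifiedDual : (Σ k, BlockIndex k) ⊕ ℕ → X →ₗ[𝕜] 𝕜 :=
  Sum.elim (fun x => blockDual (blockSign 𝕜 x.1) (fun b => U' (Sum.inl ⟨x.1, b⟩)) x.2)
    fun n => U' (Sum.inr n)

variable {U U'}

theorem modifiedVec_inl (k : ℕ) (b : BlockIndex k) : modifiedVec 𝕜 U (Sum.inl ⟨k, b⟩) =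
    blockVec (blockSign 𝕜 k) (fun b => U (Sum.inl ⟨k, b⟩)) b := rfl

theorem modifiedVec_inr (n : ℕ) : modifiedVec 𝕜 U (Sum.inr n) = U (Sum.inr n) := rfl

theorem modifiedDual_inl (k : ℕ) (b : BlockIndex k) : modifiedDual U' (Sum.inl ⟨k, b⟩) =
    blockDual (blockSign 𝕜 k) (fun b => U' (Sum.inl ⟨k, b⟩)) b := rfl

theorem modifiedDual_inr (n : ℕ) : modifiedDual U' (Sum.inr n) = U' (Sum.inr n) := rfl

theorem IsFundamentalSystem.dual_block {C : ℝ} (h : IsFundamentalSystem q C U U') (k : ℕ)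
    (b c : BlockIndex k) :
    U' (Sum.inl ⟨k, b⟩) (U (Sum.inl ⟨k, c⟩)) = if b = c then 1 else 0 := by
  split_ifs with hbc
  · rw [hbc, h.dual_self]
  · exact h.dual_of_ne _ _ (by simpa using hbc)

theorem IsFundamentalSystem.modified (hq : IsQuasiNorm 𝕜 q) {κ C : ℝ}
    (hκ1 : 1 ≤ κ) (hκ : ∀ f g, q (f + g) ≤ κ * (q f + q g)) (hC : 1 ≤ C)
    (h : IsFundamentalSystem q C U U') (hU : ∀ x, q (U (Sum.inl x)) ≤ C)
    (hU' : ∀ x f, ‖U' (Sum.inl x) f‖ ≤ C * q f)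
    (hav : ∀ (F : Finset (Σ k, BlockIndex k)) (f : X),
      q (∑ x ∈ F, U (Sum.inl x)) * ‖∑ x ∈ F, U' (Sum.inl x) f‖ ≤ C * F.card * q f) :
    IsFundamentalSystem q (16 * κ ^ 2 * C ^ 3) (modifiedVec 𝕜 U) (modifiedDual U') where
  dense_span f ε hε := by
    obtain ⟨g, hg, hfg⟩ := h.dense_span f ε hε
    refine ⟨g, ?_, hfg⟩
    refine (Submodule.span_le.2 ?_ :
      Submodule.span 𝕜 (Set.range U) ≤ Submodule.span 𝕜 (Set.range (modifiedVec 𝕜 U))) hg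
    rintro _ ⟨⟨k, b⟩ | n, rfl⟩
    · refine Submodule.span_mono ?_ (mem_span_blockVec (a := fun b => U (Sum.inl ⟨k, b⟩))
        (sum_blockSign (𝕜 := 𝕜) k) b)
      rintro _ ⟨c, rfl⟩
      exact ⟨Sum.inl ⟨k, c⟩, rfl⟩
    · exact Submodule.subset_span ⟨Sum.inr n, rfl⟩
  dual_self := by
    rintro (⟨k, b⟩ | n)
    · rw [modifiedVec_inl, modifiedDual_inl, blockDual_blockVec (sum_blockSign k) (h.dual_block k),
        if_pos rfl]
    · exact h.dual_self _
  dual_of_ne := by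
    rintro (⟨k, b⟩ | n) (⟨l, c⟩ | m) hne
    · rw [modifiedVec_inl, modifiedDual_inl]
      by_cases hkl : k = l
      · subst hkl
        have hbc : b ≠ c := by simpa using hne
        rw [blockDual_blockVec (sum_blockSign k) (h.dual_block k), if_neg hbc]
      · refine blockDual_apply_eq_zero (fun b => ?_) _
        exact apply_blockVec_eq_zero (fun c => h.dual_of_ne _ _ (by simp [hkl])) _
    · rw [modifiedVec_inr, modifiedDual_inl]
      exact blockDual_apply_eq_zero (fun b => h.dual_of_ne _ _ (by simp)) _
    · rw [modifiedVec_inl, modifiedDual_inr]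
      exact apply_blockVec_eq_zero (fun b => h.dual_of_ne _ _ (by simp)) _
    · exact h.dual_of_ne _ _ hne
  bound := by
    have hav' : ∀ k (g : Fin (2 ^ k) × Bool → BlockIndex k), Function.Injective g → ∀ f,
        q (∑ j, U (Sum.inl ⟨k, g j⟩)) * ‖∑ j, U' (Sum.inl ⟨k, g j⟩) f‖ ≤
          C * Fintype.card (Fin (2 ^ k) × Bool) * q f := fun k g hg f => by
      have := hav (Finset.univ.map ⟨fun j => (⟨k, g j⟩ : Σ k, BlockIndex k),
        sigma_mk_injective.comp hg⟩) f
      simpa only [Finset.sum_map, Finset.card_map, Finset.card_univ,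
        Function.Embedding.coeFn_mk] using this
    rintro (⟨k, b⟩ | n) f
    · rw [modifiedVec_inl, modifiedDual_inl]
      refine qnorm_blockVec_mul_le (ε := blockSign 𝕜 k) (a := fun b => U (Sum.inl ⟨k, b⟩))
        (a' := fun b => U' (Sum.inl ⟨k, b⟩)) hq hκ1 hκ hC (norm_blockSign k) (fun b => hU ⟨k, b⟩)
        (fun b => hU' ⟨k, b⟩) (fun b => h.dual_self (Sum.inl ⟨k, b⟩)) (fun b c hbc => ?_) ?_ ?_ b f
      · rw [h.dual_block, if_neg hbc]
      · exact hav' k (fun j => Sum.inl (some j)) (fun i j h => by simpa using h)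
      · exact hav' k (fun j => Sum.inr (some j)) (fun i j h => by simpa using h)
    · refine (h.bound _ f).trans (mul_le_mul_of_nonneg_right ?_ (hq.nonneg f))
      have h1 : 1 ≤ κ ^ 2 := one_le_pow₀ hκ1
      have h2 : C ≤ C ^ 3 := le_self_pow₀ hC (by norm_num)
      nlinarith

theorem apply_eq_zero_of_modifiedDual {f : X} (hf : ∀ i, modifiedDual U' i f = 0) (i) :
    U' i f = 0 := by
  rcases i with ⟨k, b⟩ | n
  · refine apply_eq_zero_of_blockDual (ε := blockSign 𝕜 k) (a' := fun b => U' (Sum.inl ⟨k, b⟩))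
      (fun b => ?_) b
    rw [← modifiedDual_inl, hf]
  · exact hf (Sum.inr n)

/-- In the `k`-th block of the modified system, `2 ^ (k + 1)` vectors add up to a bounded vector,
while half of them add up to a vector of quasi-norm at least a multiple of `2 ^ k`. -/
theorem IsFundamentalSystem.sum_modified {C : ℝ} (h : IsFundamentalSystem q C U U')
    (hU' : ∀ x f, ‖U' (Sum.inl x) f‖ ≤ C * q f) (k : ℕ) :
    ∑ j, modifiedVec 𝕜 U (Sum.inl ⟨k, Sum.inl (some j)⟩) = U (Sum.inl ⟨k, Sum.inl none⟩) ∧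
      (2 : ℝ) ^ k ≤ C * q (∑ i, modifiedVec 𝕜 U (Sum.inl ⟨k, Sum.inl (some (i, true))⟩)) := by
  have h1 := apply_sum_blockVec (ε := blockSign 𝕜 k) (a := fun b => U (Sum.inl ⟨k, b⟩))
    (a' := fun b => U' (Sum.inl ⟨k, b⟩)) (h.dual_block k) (Finset.univ ×ˢ {true})
  have h2 := hU' ⟨k, Sum.inr none⟩
    (∑ i, modifiedVec 𝕜 U (Sum.inl ⟨k, Sum.inl (some (i, true))⟩))
  simp only [Finset.sum_product, Finset.sum_singleton, ← modifiedVec_inl] at h1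
  rw [h1] at h2
  simp only [modifiedVec_inl] at h2 ⊢
  exact ⟨sum_blockVec (sum_blockSign k), by simpa [blockSign] using h2⟩

end Modified

end Assembly

theorem mainTheorem3 {𝕜 : Type*} [RCLike 𝕜] {X : Type*} [AddCommGroup X] [Module 𝕜 X]
    (q : X → ℝ) (hq : IsQuasiBanach 𝕜 q)
    (B₀ : SpaceBasis 𝕜 q) (hB₀ : B₀.IsMBounded)
    (S : SequenceSpace 𝕜) (hS : S.IsSymmetric) (hSconv : IsLocallyConvexQuasiNorm S.qnorm)
    (hcompl : IsComplementedIn 𝕜 S.qnorm q) :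
    ∃ B : SpaceBasis 𝕜 q, B.IsMBounded ∧
      (∃ c : ℝ, 0 < c ∧ ∀ m : ℕ, 1 ≤ m → ENNReal.ofReal (c * m) ≤ B.kTilde m) ∧
      (B₀.IsTotal → B.IsTotal) := by
  have hqn := hq.toIsQuasiNorm
  obtain ⟨κ, hκ1, hκ⟩ := hqn.add_le
  obtain ⟨u, u', c₀, C₀, hc₀, hu, hbd, hav, htot⟩ :=
    exists_system_of_complemented hqn B₀ hB₀ S hS hSconv hcompl
  obtain ⟨e, he⟩ := exists_equiv_sigma_sum_nat (β := BlockIndex) (fun k => by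
    have := Nat.one_le_two_pow (n := k)
    simp only [Fintype.card_sum, Fintype.card_option, Fintype.card_prod, Fintype.card_fin,
      Fintype.card_bool, pow_succ]
    omega)
  have : Infinite (Σ k, BlockIndex k) :=
    Infinite.of_injective (fun k : ℕ => (⟨k, Sum.inl none⟩ : Σ k, BlockIndex k))
      fun k l h => congrArg Sigma.fst h
  obtain ⟨d⟩ : Nonempty ((Σ k, BlockIndex k) ≃ ℕ) := nonempty_equiv_of_countable
  let E : (Σ k, BlockIndex k) ⊕ ℕ ≃ ℕ ⊕ ℕ := (d.sumCongr (Equiv.refl ℕ)).trans (Equiv.sumComm ℕ ℕ)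
  let C := max (max C₀ 1) (C₀ / c₀)
  have hC₀ : C₀ ≤ C := (le_max_left _ _).trans (le_max_left _ _)
  have hC1 : 1 ≤ C := (le_max_right _ _).trans (le_max_left _ _)
  have hC₀0 : 0 ≤ C₀ := (hqn.nonneg _).trans (hbd 0).2
  have hU : IsFundamentalSystem q C (u ∘ E) (fun i => u' (E i)) :=
    { hu.reindex E with
      bound := fun i f => ((hu.reindex E).bound i f).trans
        (mul_le_mul_of_nonneg_right hC₀ (hqn.nonneg f)) }
  have hUb : ∀ x, q ((u ∘ E) (Sum.inl x)) ≤ C := fun x => (hbd (d x)).2.trans hC₀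
  have hU'b : ∀ x f, ‖u' (E (Sum.inl x)) f‖ ≤ C * q f := fun x f => by
    refine (hu.norm_dual_le hqn _ f).trans (mul_le_mul_of_nonneg_right ?_ (hqn.nonneg f))
    refine le_trans ?_ (le_max_right _ _)
    exact div_le_div_of_nonneg_left hC₀0 hc₀ (hbd (d x)).1
  have hW := hU.modified hqn hκ1 hκ hC1 hUb hU'b (fun F f => by
    have := hav (F.map d.toEmbedding) f
    simp only [Finset.sum_map, Finset.card_map] at this
    refine le_trans this ?_
    have := hqn.nonneg f
    gcongr)
  let B := hW.toSpaceBasis hqn e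
  have hvec : ∀ i, B.vec (e.symm i) = modifiedVec 𝕜 (u ∘ E) i := fun i =>
    congrArg (modifiedVec 𝕜 (u ∘ E)) (e.apply_symm_apply i)
  refine ⟨B, SpaceBasis.isMBounded_of_bound hqn (by positivity) fun n f => hW.bound (e n) f,
    ⟨1 / (32 * C ^ 2), by positivity, fun m hm => ?_⟩, fun ht => ?_⟩
  · rcases lt_or_ge m 16 with hm16 | hm16
    · have h0 : ∑ n ∈ ({0} : Finset ℕ), B.vec n ≠ 0 := by simpa using B.vec_ne_zero 0
      refine le_trans (ENNReal.ofReal_le_ofReal ?_)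
        (B.le_kTilde hqn (m := m) subset_rfl (by simpa using Nat.lt_of_succ_le hm) h0)
      rw [div_self (hqn.pos h0).ne', one_div, inv_mul_le_iff₀ (by positivity)]
      have h1 : (m : ℝ) < 16 := by exact_mod_cast hm16
      nlinarith
    · -- The block contained in the first `m` places has size comparable to `m`.
      obtain ⟨k, hk⟩ : ∃ k, Nat.log 2 m = k + 4 :=
        Nat.exists_eq_add_of_le' (Nat.le_log_of_pow_le (by norm_num) (by simpa using hm16))
      have hkm : 2 ^ (k + 4) ≤ m := hk ▸ Nat.pow_log_le_self 2 (by omega)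
      have hmk : m < 2 ^ (k + 5) := by
        have := Nat.lt_pow_succ_log_self (b := 2) (by norm_num) m
        rwa [hk] at this
      obtain ⟨h1, h2⟩ := hU.sum_modified hU'b k
      let pos : Fin (2 ^ k) × Bool ↪ ℕ :=
        ⟨fun j => e.symm (Sum.inl ⟨k, Sum.inl (some j)⟩), fun i j h => by simpa using h⟩
      have hs : ∑ n ∈ Finset.univ.map pos, B.vec n = (u ∘ E) (Sum.inl ⟨k, Sum.inl none⟩) := by
        rw [Finset.sum_map, ← h1]
        exact Finset.sum_congr rfl fun j _ => hvec _
      have ht : ∑ n ∈ (Finset.univ ×ˢ {true}).map pos, B.vec n =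
          ∑ i, modifiedVec 𝕜 (u ∘ E) (Sum.inl ⟨k, Sum.inl (some (i, true))⟩) := by
        rw [Finset.sum_map, Finset.sum_product]
        simp only [Finset.sum_singleton]
        exact Finset.sum_congr rfl fun j _ => hvec _
      have h0 : ∑ n ∈ Finset.univ.map pos, B.vec n ≠ 0 := hs ▸ hU.vec_ne_zero _
      refine le_trans (ENNReal.ofReal_le_ofReal ?_) (B.le_kTilde hqn (m := m)
        (Finset.map_subset_map.2 (Finset.subset_univ (Finset.univ ×ˢ {true}))) (fun n hn => ?_) h0)
      · have hpos := hqn.pos h0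
        rw [le_div_iff₀ hpos, one_div, mul_assoc, inv_mul_le_iff₀ (by positivity), ht]
        rw [hs] at hpos ⊢
        have h3 : (m : ℝ) ≤ 32 * 2 ^ k := by
          have h4 : (m : ℝ) < 2 ^ (k + 5) := by exact_mod_cast hmk
          rw [pow_add] at h4
          linarith
        calc (m : ℝ) * q ((u ∘ E) (Sum.inl ⟨k, Sum.inl none⟩)) ≤ (32 * 2 ^ k) * C := by
              gcongr; exact hUb _
          _ ≤ (32 * (C * q (∑ i, modifiedVec 𝕜 (u ∘ E)
                (Sum.inl ⟨k, Sum.inl (some (i, true))⟩)))) * C := by gcongr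
          _ = _ := by ring
      · obtain ⟨j, -, rfl⟩ := Finset.mem_map.1 hn
        exact (he k _).trans_le hkm
  · intro f g hfg
    refine sub_eq_zero.1 (htot ht _ fun i => ?_)
    obtain ⟨i, rfl⟩ := E.surjective i
    refine apply_eq_zero_of_modifiedDual (U' := fun i => u' (E i)) (fun i => ?_) i
    obtain ⟨n, rfl⟩ := e.surjective i
    rw [map_sub, sub_eq_zero]
    exact congrFun hfg n
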